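/- For a real number $x$ with $0\le x\le 1$ and non-zero integers $s_1,\dots,s_k$ let \[ \zeta_x(s_1,\dots,s_k)=\sum_{n_1>\cdots>n_k>0}x^{n_1}\prod_{j=1}^k n_j^{-|s_j|}\sigma_j^{-n_j},\qquad \sigma_j=\operatorname{sgn}(s_j), \] whenever this converges (as the limit, as $N\to\infty$, of the finite sums over $N>n_1>\cdots>n_k>0$), with value $1$ for the empty string of arguments. Write $\zeta=\zeta_1$, write $\overline{1}$ for the argument $-1$, and write $\{w\}^n$ for the string $w$ repeated $n$ times. Let ${}_2F_1$ be the Gaussian hypergeometric series, and for complex $z$ put \[ Y_1(s,z)={}_2F_1(z,-z;1;s)\ (|s|\le 1),\qquad Y_2(s,z)=(1-s)\,{}_2F_1(1+z,1-z;2;1-s)\ (|1-s|<1), \] \[ U(s,z)=Y_1(s,z)-zY_2(s,z),\qquad A(z)=\sum_{n=0}^\infty z^n\zeta(\{\overline{1}\}^n). \] The sums $\zeta(\{\overline 1\}^n)$ converge, and the series $A(z)$ converges for every complex $z$. For each real $x$ with $0\le x\le 1$, the sums $\zeta_x(\{\overline{1},1\}^n)$ and $\zeta_x(\overline{1},\{1,\overline{1}\}^n)$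 converge for all $n\ge 0$, and the formal power series \[ M(x,t)=\sum_{n=0}^\infty\Big[t^{2n}\zeta_x(\{\overline{1},1\}^n)+t^{2n+1}\zeta_x(\overline{1},\{1,\overline{1}\}^n)\Big] \] converges for all complex $t$ and defines an entire function of $t$. Furthermore, if $z=(1+i)t/2$ and $s=(1+x)/2$, then \[ M(x,t)=\frac{U(s,-z)\,U(s,iz)}{A(-z)\,A(iz)} \] for all pairs $(x,t)$ with $0\le x\le 1$, $t\in\mathbb{C}$, for which the right-hand side is defined, that is, for which $A(-z)A(iz)\ne 0$. -/

import Mathlib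

open Filter Topology

namespace EulerSums

/-- Truncated parametrized multiple zeta sum
`∑_{N > n₁ > ⋯ > nₖ > 0} x ^ n₁ ∏ⱼ σⱼ ^ nⱼ / nⱼ ^ |sⱼ|`, where `σⱼ = sign sⱼ`, so that the barred
argument `s̄` is encoded as the negative integer `-s` (and `σ ^ n = σ ^ (-n)` as `σ = ±1`).
The sum with no arguments is `1`. -/
noncomputable def zetaTrunc : ℝ → List ℤ → ℕ → ℝ
  | _, [], _ => 1
  | x, s :: l, N =>
      ∑ n ∈ Finset.Ico 1 N, x ^ n * ((s.sign : ℝ) ^ n / (n : ℝ) ^ s.natAbs) * zetaTrunc 1 l n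

/-- The parametrized multiple zeta function (parametrized Euler sum) `ζ_x(s₁, …, sₖ)`: the limit
of the truncated sums. At `x = 1` it is the Euler sum `ζ(s₁, …, sₖ)`, which may converge only
conditionally. -/
noncomputable def zetaX (x : ℝ) (l : List ℤ) : ℝ :=
  limUnder atTop (zetaTrunc x l)

/-- The string `{1̄, 1}ⁿ`. -/
def wordEven (n : ℕ) : List ℤ := (List.replicate n [-1, 1]).flatten

/-- The string `1̄, {1, 1̄}ⁿ`. -/
def wordOdd (n : ℕ) : List ℤ := -1 :: (List.replicate n [1, -1]).flatten

/-- The string `{1̄}ⁿ`. -/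
def wordBar (n : ℕ) : List ℤ := List.replicate n (-1)

/-- `M(x,t) = ∑ₙ [t²ⁿ ζ_x({1̄,1}ⁿ) + t²ⁿ⁺¹ ζ_x(1̄,{1,1̄}ⁿ)]`. -/
noncomputable def M (x : ℝ) (t : ℂ) : ℂ :=
  ∑' n : ℕ, (t ^ (2 * n) * (zetaX x (wordEven n) : ℂ)
    + t ^ (2 * n + 1) * (zetaX x (wordOdd n) : ℂ))

/-- `A(z) = ∑ₙ zⁿ ζ({1̄}ⁿ)`. -/
noncomputable def A (z : ℂ) : ℂ :=
  ∑' n : ℕ, z ^ n * (zetaX 1 (wordBar n) : ℂ)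

/-- `Y₁(x,z) = ₂F₁(z, -z; 1; x)`. -/
noncomputable def Y₁ (x z : ℂ) : ℂ := ordinaryHypergeometric z (-z) (1 : ℂ) x

/-- `Y₂(x,z) = (1 - x) ₂F₁(1 + z, 1 - z; 2; 1 - x)`. -/
noncomputable def Y₂ (x z : ℂ) : ℂ :=
  (1 - x) * ordinaryHypergeometric (1 + z) (1 - z) (2 : ℂ) (1 - x)

/-- `U(s,z) = Y₁(s,z) - z Y₂(s,z)`. -/
noncomputable def U (s z : ℂ) : ℂ := Y₁ s z - z * Y₂ s z

end EulerSums

/-!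
Write `a_w(y) = 1 + w ∑ yⁿ eₙ / n`, where `eₙ = ∏_{j<n} (1 + (-1)ʲ w / j)` is the generating
function over the depth of the truncated sums of the words `{1̄}ᵏ`. The recursion
`eₙ₊₁ = eₙ + w (-1)ⁿ eₙ / n` amounts to the equation `(1 - y) a_w'(y) = w a_w(-y)`, and
`a_w(-1) = A(w)`. In the same way the generating functions `G` and `F` of the alternating words
beginning with `1` and with `1̄` satisfy `(1 - y) G'(y) = t F(y)` and `(1 - y) F'(y) = t G(-y)`, and
`M(x, t) = G(-x)`.

* With `z = (1 + i) t / 2` one has `z² + (-iz)² = 0`. Therefore `a_z a_{-iz}`, with a suitable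
  partner for `F`, solves the system of `G` and `F`, and `M(x, t) = a_z(-x) a_{-iz}(-x)` by uniqueness
  (`altSeries_eq_mul`, `M_eq_mul`).
* Put `s = (1 - y) / 2`. The hypergeometric equation of `U(s, w)` becomes
  `(1 - y) V'(y) = -w V(-y)` for `V(y) = U(s, w)`, so that `U(s, w) = U(1/2, w) a_{-w}(y)`
  (`centredU_eq_mul`).
* At `y = -1` the partial sums of `₂F₁(w, -w; 1; 1)` telescope to `∏ (1 - w² / j²)`, whose limit is
  also `A(w) A(-w)` (`centredU_neg_one`). Hence `U(1/2, w) A(-w) = A(w) A(-w)`, and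
  `U(1/2, w) = A(w)` by the identity theorem (`centredU_zero_eq_A`).

The endpoint `x = 1`, where the sums converge only conditionally, needs an estimate: the truncated
sums of depth `k` are `O(τ⁻ᵏ √n)` for every `τ > 0` (`alternating_rapidDecay`). It is proved by
merging successive steps of the recursion, in which the signs cancel. Summation by parts then turns
every series that occurs into an absolutely convergent one, uniformly for `0 ≤ x ≤ 1`.
-/

namespace EulerSums

/-! ### Power series with logarithmic singularities -/

/-- The power series `∑ hₙ yⁿ / n`; the term `n = 0` vanishes, because `h₀ / 0 = 0`. -/
noncomputable def logSeries (h : ℕ → ℂ) (y : ℝ) : ℂ :=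
  ∑' n : ℕ, (y : ℂ) ^ n * (h n / n)

lemma summable_linear_mul_pow (C : ℝ) {r : ℝ} (hr0 : 0 ≤ r) (hr : r < 1) :
    Summable fun n : ℕ => C * ((n : ℝ) + 1) * r ^ n := by
  have h1 := summable_pow_mul_geometric_of_norm_lt_one (R := ℝ) 1
    (r := r) (by rwa [Real.norm_of_nonneg hr0])
  have h2 := summable_geometric_of_lt_one hr0 hr
  refine ((h1.add h2).mul_left C).congr fun n => ?_
  ring

lemma summable_pow_mul_of_linear_growth {h : ℕ → ℂ} {C : ℝ}
    (hh : ∀ n, ‖h n‖ ≤ C * ((n : ℝ) + 1)) {y : ℝ} (hy : |y| < 1) :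
    Summable fun n : ℕ => (y : ℂ) ^ n * h n := by
  refine Summable.of_norm_bounded (summable_linear_mul_pow C (abs_nonneg y) hy) fun n => ?_
  rw [norm_mul, norm_pow, Complex.norm_real, Real.norm_eq_abs, mul_comm]
  exact mul_le_mul_of_nonneg_right (hh n) (by positivity)

lemma logSeries_zero (h : ℕ → ℂ) : logSeries h 0 = 0 := by
  have : ∀ n : ℕ, ((0 : ℝ) : ℂ) ^ n * (h n / n) = 0 := by
    intro n
    rcases n with _ | n <;> simp
  simp only [logSeries, this, tsum_zero]

lemma norm_div_natCast_le {h : ℕ → ℂ} {C : ℝ} (hh : ∀ n, ‖h n‖ ≤ C * ((n : ℝ) + 1)) (n : ℕ) :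
    ‖h n / n‖ ≤ (2 * C) * ((n : ℝ) + 1) := by
  have hC : 0 ≤ C := by simpa using (norm_nonneg _).trans (hh 0)
  have hn : ‖h n / n‖ ≤ ‖h n‖ := by
    rw [norm_div, Complex.norm_natCast]
    rcases n with _ | n
    · simp
    · exact div_le_self (norm_nonneg _) (by push_cast; linarith [Nat.cast_nonneg (α := ℝ) n])
  refine hn.trans ((hh n).trans ?_)
  have : 0 ≤ C * ((n : ℝ) + 1) := by positivity
  linarith

/-- Termwise differentiation; the factors `n` and `1 / n` cancel. -/
lemma hasDerivAt_logSeries_tsum {h : ℕ → ℂ} {C : ℝ} (hh : ∀ n, ‖h n‖ ≤ C * ((n : ℝ) + 1))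
    {y : ℝ} (hy : |y| < 1) :
    HasDerivAt (logSeries h) (∑' n : ℕ, (y : ℂ) ^ n * h (n + 1)) y := by
  have hC : 0 ≤ C := by simpa using (norm_nonneg _).trans (hh 0)
  obtain ⟨r, hyr, hr⟩ := exists_between hy
  have hr0 : 0 ≤ r := (abs_nonneg y).trans hyr.le
  set g' : ℕ → ℝ → ℂ := fun n y => (n * (y : ℂ) ^ (n - 1)) * (h n / n)
  have hg'_succ : ∀ (n : ℕ) (y : ℝ), g' (n + 1) y = (y : ℂ) ^ n * h (n + 1) := by
    intro n y
    have : ((n : ℂ) + 1) ≠ 0 := by exact_mod_cast n.succ_ne_zero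
    simp only [g', Nat.add_sub_cancel]
    push_cast
    field_simp
  have hg'0 : ∀ y : ℝ, g' 0 y = 0 := fun y => by simp [g']
  set u : ℕ → ℝ := fun n => 2 * C * ((n : ℝ) + 1) * r ^ (n - 1)
  have hu : Summable u := by
    rw [← summable_nat_add_iff 1]
    refine ((summable_linear_mul_pow (2 * C) hr0 hr).add
      ((summable_geometric_of_lt_one hr0 hr).mul_left (2 * C))).congr fun n => ?_
    simp only [u, Nat.add_sub_cancel]
    push_cast
    ring
  have key := hasDerivAt_tsum_of_isPreconnected (𝕜 := ℝ) (g := fun n (y : ℝ) => (y : ℂ) ^ n * (h n / n))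
    (g' := g') (u := u) (t := Set.Ioo (-r) r) (y₀ := 0) (y := y) hu isOpen_Ioo isPreconnected_Ioo
    (fun n y _ => ((hasDerivAt_pow n (y : ℂ)).comp_ofReal).mul_const _) ?_ ?_ ?_ ?_
  · refine key.congr_deriv ?_
    have hs : Summable fun n => g' n y := by
      rw [← summable_nat_add_iff 1]
      simp only [hg'_succ]
      refine summable_pow_mul_of_linear_growth (C := 2 * C) (fun n => (hh _).trans ?_) hy
      push_cast
      nlinarith [mul_nonneg hC (Nat.cast_nonneg (α := ℝ) n)]
    rw [hs.tsum_eq_zero_add, hg'0, zero_add]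
    simp only [hg'_succ]
  · intro n y hy
    rcases n with _ | n
    · rw [hg'0, norm_zero]
      simp only [u]
      positivity
    · rw [hg'_succ, norm_mul, norm_pow, Complex.norm_real, Real.norm_eq_abs, mul_comm]
      simp only [u, Nat.add_sub_cancel]
      have h1 : |y| ≤ r := (abs_lt.mpr hy).le
      have h2 := hh (n + 1)
      have h3 : 0 ≤ C * (((n + 1 : ℕ) : ℝ) + 1) := by positivity
      gcongr
      linarith
  · constructor
    · linarith [abs_nonneg y]
    · linarith [abs_nonneg y]
  · simpa using summable_pow_mul_of_linear_growth (norm_div_natCast_le hh) (y := 0) (by simp)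
  · exact abs_lt.mp hyr

/-- A recursion `hₙ₊₁ - hₙ = w ηⁿ h'ₙ / n` for the coefficients is a differential equation for the
series: the factor `1 / (1 - y)` sums the differences up. -/
lemma hasDerivAt_logSeries {h h' : ℕ → ℂ} {C : ℝ} {w : ℂ} {η : ℝ}
    (hh : ∀ n, ‖h n‖ ≤ C * ((n : ℝ) + 1)) (h0 : h 0 = 1)
    (hstep : ∀ n, h (n + 1) = h n + w * ((η : ℂ) ^ n * (h' n / n)))
    {y : ℝ} (hy : |y| < 1) :
    HasDerivAt (logSeries h) ((1 + w * logSeries h' (η * y)) / (1 - y)) y := by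
  refine (hasDerivAt_logSeries_tsum hh hy).congr_deriv ?_
  have hy1 : (1 : ℂ) - y ≠ 0 := by
    rw [sub_ne_zero]
    norm_cast
    exact (lt_of_abs_lt hy).ne'
  have hs := summable_pow_mul_of_linear_growth hh hy
  have hC : 0 ≤ C := by simpa using (norm_nonneg _).trans (hh 0)
  have hs1 : Summable fun n : ℕ => (y : ℂ) ^ n * h (n + 1) := by
    refine summable_pow_mul_of_linear_growth (C := 2 * C) (fun n => (hh _).trans ?_) hy
    push_cast
    nlinarith [mul_nonneg hC (Nat.cast_nonneg (α := ℝ) n)]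
  have e1 : ∑' n : ℕ, (y : ℂ) ^ n * h n = 1 + y * ∑' n : ℕ, (y : ℂ) ^ n * h (n + 1) := by
    rw [hs.tsum_eq_zero_add, ← tsum_mul_left, h0]
    simp only [pow_zero, mul_one]
    congr 1
    exact tsum_congr fun n => by ring
  have e2 : w * logSeries h' (η * y)
      = ∑' n : ℕ, (y : ℂ) ^ n * h (n + 1) - ∑' n : ℕ, (y : ℂ) ^ n * h n := by
    rw [← hs1.tsum_sub hs, logSeries, ← tsum_mul_left]
    refine tsum_congr fun n => ?_
    rw [hstep]
    push_cast
    ring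
  rw [eq_div_iff hy1, e2, e1]
  ring

lemma continuousOn_logSeries {h : ℕ → ℂ} {C : ℝ} (hh : ∀ n, ‖h n‖ ≤ C * ((n : ℝ) + 1)) :
    ContinuousOn (logSeries h) (Set.Ioo (-1) 1) := fun _ hy =>
  (hasDerivAt_logSeries_tsum hh (abs_lt.mpr hy)).continuousAt.continuousWithinAt

/-! ### Uniqueness for Fuchsian linear systems -/

/-- A solution of a linear system with coefficients `O(1 / (1 - x))` on `[0, 1)`, in which each
derivative involves a single unknown, vanishes if it vanishes at `0`. -/
lemma eq_zero_of_linear_system {n : ℕ} {Y : Fin n → ℝ → ℂ} {c : Fin n → ℝ → ℂ}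
    {π : Fin n → Fin n} {K : ℝ} (hK : 0 ≤ K)
    (hc : ∀ i x, 0 ≤ x → x < 1 → ‖c i x‖ ≤ K / (1 - x))
    (hY : ∀ i x, 0 ≤ x → x < 1 → HasDerivAt (Y i) (c i x * Y (π i) x) x)
    (h0 : ∀ i, Y i 0 = 0) (i : Fin n) {x : ℝ} (hx0 : 0 ≤ x) (hx1 : x < 1) : Y i x = 0 := by
  have hd : ∀ x, 0 ≤ x → x < 1 → HasDerivAt (fun x i => Y i x) (fun i => c i x * Y (π i) x) x :=
    fun x hx0 hx1 => hasDerivAt_pi.mpr fun i => hY i x hx0 hx1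
  have key := eq_zero_of_abs_deriv_le_mul_abs_self_of_eq_zero_right
    (f := fun x i => Y i x) (f' := fun x i => c i x * Y (π i) x) (K := K / (1 - x)) (a := 0) (b := x)
    (fun y hy => (hd y hy.1 (hy.2.trans_lt hx1)).continuousAt.continuousWithinAt)
    (fun y hy => (hd y hy.1 (hy.2.trans hx1)).hasDerivWithinAt) (funext h0) ?_ x ⟨hx0, le_rfl⟩
  · exact congrFun key i
  · intro y hy
    have hy1 : y < 1 := hy.2.trans hx1
    have hpos : 0 ≤ K / (1 - x) := div_nonneg hK (by linarith)
    refine (pi_norm_le_iff_of_nonneg (by positivity)).mpr fun j => ?_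
    rw [norm_mul]
    have h1 : ‖c j y‖ ≤ K / (1 - x) := (hc j y hy.1 hy1).trans
      (div_le_div_of_nonneg_left hK (by linarith) (by linarith [hy.2]))
    exact mul_le_mul h1 (norm_le_pi_norm (fun i => Y i y) (π j)) (norm_nonneg _) hpos

/-! ### Entire power series -/

/-- A bound at the radius `2 (r + 1)` gives a geometrically decaying bound at the radius `r`. -/
lemma pow_mul_le_geometric {a r C : ℝ} {k : ℕ} (ha : 0 ≤ a) (hr : 0 ≤ r)
    (h : (2 * (r + 1)) ^ k * a ≤ C) : r ^ k * a ≤ C * (1 / 2) ^ k := by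
  rw [mul_pow] at h
  have h1 : r ^ k * a ≤ (r + 1) ^ k * a := by
    gcongr
    linarith
  refine h1.trans ?_
  rw [one_div, inv_pow, ← div_eq_mul_inv, le_div_iff₀ (by positivity)]
  linarith

lemma summable_of_rapid_decay {c : ℕ → ℂ} (hc : ∀ τ : ℝ, 0 < τ → ∃ C, ∀ k, τ ^ k * ‖c k‖ ≤ C)
    (t : ℂ) : Summable fun k : ℕ => t ^ k * c k := by
  obtain ⟨C, hC⟩ := hc (2 * (‖t‖ + 1)) (by positivity)
  refine Summable.of_norm_bounded (summable_geometric_two.mul_left C) fun k => ?_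
  rw [norm_mul, norm_pow]
  exact pow_mul_le_geometric (norm_nonneg _) (norm_nonneg _) (hC k)

lemma differentiable_of_rapid_decay {c : ℕ → ℂ}
    (hc : ∀ τ : ℝ, 0 < τ → ∃ C, ∀ k, τ ^ k * ‖c k‖ ≤ C) :
    Differentiable ℂ fun t : ℂ => ∑' k : ℕ, t ^ k * c k := by
  intro t
  have hs := (summable_of_rapid_decay hc ((‖t‖ + 1 : ℝ) : ℂ)).norm
  have := Complex.differentiableOn_tsum_of_summable_norm (U := Metric.ball (0 : ℂ) (‖t‖ + 1))
    (F := fun (k : ℕ) (t : ℂ) => t ^ k * c k) hs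
    (fun k => ((differentiable_id.pow k).mul_const _).differentiableOn) Metric.isOpen_ball ?_
  · exact this.differentiableAt (Metric.isOpen_ball.mem_nhds (by simp))
  · intro k w hw
    have : ‖w‖ ≤ ‖t‖ + 1 := (mem_ball_zero_iff.mp hw).le
    rw [norm_mul, norm_mul, norm_pow, norm_pow, Complex.norm_real,
      Real.norm_of_nonneg (by positivity)]
    gcongr

/-! ### Families of truncated sums indexed by depth -/

/-- The recursion in the truncation bound `n` satisfied by truncated sums `H k n` of depth `k`
whose outermost summation has sign `η`, the inner sums of depth `k` being `H' k n`. -/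
structure IsNested (η : ℝ) (H H' : ℕ → ℕ → ℝ) : Prop where
  depth_zero : ∀ n, H 0 n = 1
  trunc_zero : ∀ k, H (k + 1) 0 = 0
  step : ∀ k n, H (k + 1) (n + 1) = H (k + 1) n + η ^ n / n * H' k n

/-- Superexponential decay in the depth `k`, locally uniform up to a factor `√n` in the
truncation bound `n`. -/
def RapidDecay (H : ℕ → ℕ → ℝ) : Prop :=
  ∀ τ : ℝ, 0 < τ → ∃ C, ∀ k n, τ ^ k * |H k n| ≤ C * √((n : ℝ) + 1)

/-- The generating function `∑ₖ tᵏ H k n` over the depth. -/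
noncomputable def depthGen (H : ℕ → ℕ → ℝ) (t : ℂ) (n : ℕ) : ℂ :=
  ∑' k : ℕ, t ^ k * (H k n : ℂ)

/-- The function `1 + t ∑ₙ yⁿ hₙ(t) / n`, where `hₙ(t)` is the depth generating function of `H`. -/
noncomputable def nestedSeries (H : ℕ → ℕ → ℝ) (t : ℂ) (y : ℝ) : ℂ :=
  1 + t * logSeries (depthGen H t) y

variable {H H' : ℕ → ℕ → ℝ} {η : ℝ}

lemma RapidDecay.summable (hH : RapidDecay H) (t : ℂ) (n : ℕ) :
    Summable fun k : ℕ => t ^ k * (H k n : ℂ) := by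
  refine summable_of_rapid_decay (fun τ hτ => ?_) t
  obtain ⟨C, hC⟩ := hH τ hτ
  exact ⟨_, fun k => by simpa using hC k n⟩

/-- The gain of a factor `2⁻ᵏ` in the rapid decay, with the square root discarded. -/
lemma RapidDecay.geometric_bound (hH : RapidDecay H) (t : ℂ) :
    ∃ C, 0 ≤ C ∧ ∀ k n, ‖t ^ k * (H k n : ℂ)‖ ≤ C * ((n : ℝ) + 1) * (1 / 2) ^ k := by
  obtain ⟨C, hC⟩ := hH (2 * (‖t‖ + 1)) (by positivity)
  have hC0 : 0 ≤ C := by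
    simpa using (abs_nonneg (H 0 0)).trans (by simpa using hC 0 0)
  refine ⟨C, hC0, fun k n => ?_⟩
  have h2 : √((n : ℝ) + 1) ≤ (n : ℝ) + 1 := by
    rw [Real.sqrt_le_left (by positivity)]
    nlinarith [Nat.cast_nonneg (α := ℝ) n]
  rw [norm_mul, norm_pow, Complex.norm_real, Real.norm_eq_abs]
  refine (pow_mul_le_geometric (abs_nonneg _) (norm_nonneg _) (hC k n)).trans ?_
  gcongr

lemma RapidDecay.norm_depthGen_le (hH : RapidDecay H) (t : ℂ) :
    ∃ C, ∀ n, ‖depthGen H t n‖ ≤ C * ((n : ℝ) + 1) := by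
  obtain ⟨C, hC0, hC⟩ := hH.geometric_bound t
  refine ⟨C * 2, fun n => ?_⟩
  have := tsum_of_norm_bounded (hasSum_geometric_two.mul_left (C * ((n : ℝ) + 1))) (fun k => hC k n)
  refine this.trans (le_of_eq (by ring))

lemma IsNested.depthGen_zero (h : IsNested η H H') (t : ℂ) : depthGen H t 0 = 1 := by
  rw [depthGen, tsum_eq_single 0]
  · simp [h.depth_zero]
  · intro k hk
    obtain ⟨k, rfl⟩ := Nat.exists_eq_succ_of_ne_zero hk
    simp [h.trunc_zero]

lemma IsNested.depthGen_succ (h : IsNested η H H') (hH : RapidDecay H) (t : ℂ) (n : ℕ) :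
    depthGen H t (n + 1)
      = depthGen H t n + t * ((η : ℂ) ^ n * (depthGen H' t n / n)) := by
  have e : t * ((η : ℂ) ^ n * (depthGen H' t n / n))
      = ∑' k : ℕ, t ^ (k + 1) * ((H (k + 1) (n + 1) : ℂ) - H (k + 1) n) := by
    have : t * ((η : ℂ) ^ n * (depthGen H' t n / n))
        = (t * (η : ℂ) ^ n / n) * depthGen H' t n := by ring
    rw [this, depthGen, ← tsum_mul_left]
    refine tsum_congr fun k => ?_
    rw [h.step]
    push_cast
    ring
  rw [e, depthGen, depthGen, (hH.summable t (n + 1)).tsum_eq_zero_add,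
    (hH.summable t n).tsum_eq_zero_add, h.depth_zero, h.depth_zero, add_assoc,
    ← Summable.tsum_add ((summable_nat_add_iff 1).mpr (hH.summable t n))]
  · congr 1
    exact tsum_congr fun k => by ring
  · simp only [mul_sub]
    exact ((summable_nat_add_iff 1).mpr (hH.summable t (n + 1))).sub
      ((summable_nat_add_iff 1).mpr (hH.summable t n))

lemma IsNested.hasDerivAt_nestedSeries (h : IsNested η H H') (hH : RapidDecay H) (t : ℂ)
    {y : ℝ} (hy : |y| < 1) :
    HasDerivAt (nestedSeries H t) (t * nestedSeries H' t (η * y) / (1 - y)) y := by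
  obtain ⟨C, hC⟩ := hH.norm_depthGen_le t
  have := ((hasDerivAt_logSeries hC (h.depthGen_zero t) (h.depthGen_succ hH t) hy).const_mul
    t).const_add 1
  refine this.congr_deriv ?_
  rw [nestedSeries, mul_div_assoc]

lemma nestedSeries_at_zero (H : ℕ → ℕ → ℝ) (t : ℂ) : nestedSeries H t 0 = 1 := by
  simp [nestedSeries, logSeries_zero]

/-! ### Convergence up to the endpoint by summation by parts -/

/-- The differences of the coefficients `H k n / n`. For `n = 0` the value is `0`, and for `n = 1`
it is `H k 1`, because division by `0` gives `0`. -/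
noncomputable def coeffDiff (H : ℕ → ℕ → ℝ) (k n : ℕ) : ℝ :=
  H k n / n - H k (n - 1) / ((n - 1 : ℕ) : ℝ)

lemma summable_rpow_bound (D : ℝ) :
    Summable fun n : ℕ => D * (1 / (n : ℝ) ^ (3 / 2 : ℝ)) :=
  (Real.summable_one_div_nat_rpow.mpr (by norm_num)).mul_left D

/-- Consecutive differences of `H k n / n` decay like `n⁻³ᐟ²`, so that the differenced series
converges absolutely even where the original one does not. -/
lemma IsNested.coeffDiff_bound (h : IsNested η H H') (hη : |η| = 1) (hH : RapidDecay H)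
    (hH' : RapidDecay H') {τ : ℝ} (hτ : 0 < τ) :
    ∃ D, ∀ k n, τ ^ k * |coeffDiff H k n| ≤ D * (1 / (n : ℝ) ^ (3 / 2 : ℝ)) := by
  obtain ⟨C, hC⟩ := hH τ hτ
  obtain ⟨C', hC'⟩ := hH' τ hτ
  have hC0 : 0 ≤ C := by
    simpa using (abs_nonneg (H 0 0)).trans (by simpa using hC 0 0)
  have hC0' : 0 ≤ C' := by
    have := (abs_nonneg (H' 0 0)).trans (by simpa using hC' 0 0)
    simpa using this
  refine ⟨4 * (C + τ * C'), fun k n => ?_⟩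
  have hD : 0 ≤ C + τ * C' := by positivity
  rcases n with _ | _ | n
  · have : (0 : ℝ) ^ (3 / 2 : ℝ) = 0 := Real.zero_rpow (by norm_num)
    simp [coeffDiff, this]
  · have h1 := hC k 1
    have h2 : √((1 : ℝ) + 1) ≤ 2 := by
      rw [Real.sqrt_le_left (by norm_num)]
      norm_num
    have h3 : coeffDiff H k 1 = H k 1 := by simp [coeffDiff]
    simp only [zero_add, h3, Nat.cast_one, Real.one_rpow, div_one, mul_one] at h1 ⊢
    nlinarith
  · set m : ℝ := (n : ℝ) + 1 with hm
    have hm0 : 0 < m := by positivity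
    have hm1 : 1 ≤ m := by rw [hm]; linarith [Nat.cast_nonneg (α := ℝ) n]
    have hpow : (((n + 1 + 1 : ℕ) : ℝ)) ^ (3 / 2 : ℝ) = (m + 1) * √(m + 1) := by
      have : (3 / 2 : ℝ) = 1 + 1 / 2 := by norm_num
      rw [this, Real.rpow_add (by positivity), Real.rpow_one, ← Real.sqrt_eq_rpow]
      push_cast
      simp only [hm]
    have hs : √(m + 1) * √(m + 1) = m + 1 := Real.mul_self_sqrt (by positivity)
    have hs0 : 0 < √(m + 1) := Real.sqrt_pos.mpr (by positivity)
    -- the bound for the increment of `H` in the truncation bound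
    have hinc : τ ^ k * |H k (n + 1 + 1) - H k (n + 1)| ≤ τ * C' * √(m + 1) / m := by
      rcases k with _ | k
      · rw [h.depth_zero, h.depth_zero]
        simp only [sub_self, abs_zero, mul_zero]
        positivity
      · rw [h.step, add_sub_cancel_left, abs_mul, abs_div, abs_pow, hη, one_pow]
        have := hC' k (n + 1)
        push_cast at this ⊢
        rw [← hm] at this ⊢
        rw [abs_of_pos hm0, pow_succ]
        calc τ ^ k * τ * (1 / m * |H' k (n + 1)|) = τ * (τ ^ k * |H' k (n + 1)|) / m := by ring
          _ ≤ τ * (C' * √(m + 1)) / m := by gcongr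
          _ = _ := by ring
    have hval := hC k (n + 1)
    push_cast at hval
    rw [← hm] at hval
    have hdec : coeffDiff H k (n + 1 + 1)
        = (H k (n + 1 + 1) - H k (n + 1)) / (m + 1) - H k (n + 1) / (m * (m + 1)) := by
      simp only [coeffDiff, Nat.add_sub_cancel]
      push_cast
      rw [← hm]
      field_simp
      ring
    have habs : |coeffDiff H k (n + 1 + 1)|
        ≤ |H k (n + 1 + 1) - H k (n + 1)| / (m + 1) + |H k (n + 1)| / (m * (m + 1)) := by
      rw [hdec]
      refine (abs_sub _ _).trans (le_of_eq ?_)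
      rw [abs_div, abs_div, abs_of_pos (by positivity : 0 < m + 1),
        abs_of_pos (by positivity : 0 < m * (m + 1))]
    rw [hpow]
    calc τ ^ k * |coeffDiff H k (n + 1 + 1)|
        ≤ τ ^ k * (|H k (n + 1 + 1) - H k (n + 1)| / (m + 1) + |H k (n + 1)| / (m * (m + 1))) := by
          gcongr
      _ = (τ ^ k * |H k (n + 1 + 1) - H k (n + 1)|) / (m + 1)
          + (τ ^ k * |H k (n + 1)|) / (m * (m + 1)) := by ring
      _ ≤ (τ * C' * √(m + 1) / m) / (m + 1) + (C * √(m + 1)) / (m * (m + 1)) := by gcongr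
      _ = (C + τ * C') * (√(m + 1) / (m * (m + 1))) := by
          field_simp
          ring
      _ ≤ (C + τ * C') * (4 * (1 / ((m + 1) * √(m + 1)))) := by
          gcongr
          rw [mul_one_div, div_le_div_iff₀ (by positivity) (by positivity)]
          nlinarith
      _ = _ := by ring

/-- The value at `y` of the series `∑ₙ yⁿ H k n / n`, summed by parts. It agrees with the series
wherever that converges and `y ≠ 1`. -/
noncomputable def partsSum (H : ℕ → ℕ → ℝ) (k : ℕ) (y : ℝ) : ℝ :=
  (∑' n : ℕ, y ^ n * coeffDiff H k n) / (1 - y)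

/-- Summation by parts; for `n = 0` the difference is `u 0 - u 0`. -/
lemma one_sub_mul_sum_range (y : ℝ) (u : ℕ → ℝ) (hu : u 0 = 0) (N : ℕ) :
    (1 - y) * ∑ n ∈ Finset.range N, y ^ n * u n
      = ∑ n ∈ Finset.range N, y ^ n * (u n - u (n - 1)) - y ^ N * u (N - 1) := by
  induction N with
  | zero => simp [hu]
  | succ N ih =>
    rw [Finset.sum_range_succ, Finset.sum_range_succ, mul_add, ih, Nat.add_sub_cancel]
    ring

/-- The series `∑ₙ yⁿ H k n / n` converges on the closed interval `[-1, 1)`, conditionally at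
`y = -1`. -/
lemma tendsto_sum_range_partsSum (h : IsNested η H H') (hη : |η| = 1) (hH : RapidDecay H)
    (hH' : RapidDecay H') (k : ℕ) {y : ℝ} (hy : |y| ≤ 1) (hy1 : y ≠ 1) :
    Tendsto (fun N => ∑ n ∈ Finset.range N, y ^ n * (H k n / n)) atTop (𝓝 (partsSum H k y)) := by
  obtain ⟨D, hD⟩ := h.coeffDiff_bound hη hH hH' one_pos
  obtain ⟨C, hC⟩ := hH 1 one_pos
  have hs : Summable fun n : ℕ => y ^ n * coeffDiff H k n := by
    refine Summable.of_norm_bounded (summable_rpow_bound D) fun n => ?_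
    have := hD k n
    rw [one_pow, one_mul] at this
    rw [norm_mul, norm_pow, Real.norm_eq_abs, Real.norm_eq_abs]
    exact (mul_le_of_le_one_left (abs_nonneg _) (pow_le_one₀ (abs_nonneg _) hy)).trans this
  have hlim : Tendsto (fun N : ℕ => y ^ N * (H k (N - 1) / ((N - 1 : ℕ) : ℝ))) atTop (𝓝 0) := by
    rw [← tendsto_add_atTop_iff_nat 2]
    have hz : Tendsto (fun N : ℕ => 2 * C * (√((N : ℝ) + 2))⁻¹) atTop (𝓝 0) := by
      have : Tendsto (fun N : ℕ => √((N : ℝ) + 2)) atTop atTop :=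
        Real.tendsto_sqrt_atTop.comp
          (tendsto_atTop_add_const_right _ _ tendsto_natCast_atTop_atTop)
      simpa using this.inv_tendsto_atTop.const_mul (2 * C)
    refine squeeze_zero_norm (fun N => ?_) hz
    have h1 := hC k (N + 1)
    rw [one_pow, one_mul] at h1
    have hC0 : 0 ≤ C := by
      have := (abs_nonneg (H 0 0)).trans (by simpa using hC 0 0)
      simpa using this
    have hN : (0 : ℝ) ≤ N := Nat.cast_nonneg N
    have hs0 : 0 < √((N : ℝ) + 2) := Real.sqrt_pos.mpr (by positivity)
    have hss : √((N : ℝ) + 2) * √((N : ℝ) + 2) = N + 2 := Real.mul_self_sqrt (by positivity)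
    have h2 : √(((N + 1 : ℕ) : ℝ) + 1) = √((N : ℝ) + 2) := by
      push_cast
      congr 1
      ring
    rw [h2] at h1
    have h3 : N + 2 - 1 = N + 1 := rfl
    rw [h3, norm_mul, norm_pow, Real.norm_eq_abs, Real.norm_eq_abs, abs_div, Nat.abs_cast]
    push_cast
    calc |y| ^ (N + 2) * (|H k (N + 1)| / (N + 1)) ≤ 1 * ((C * √((N : ℝ) + 2)) / (N + 1)) := by
          gcongr
          exact pow_le_one₀ (abs_nonneg _) hy
      _ ≤ 2 * C * (√((N : ℝ) + 2))⁻¹ := by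
          rw [one_mul, ← div_eq_mul_inv, div_le_div_iff₀ (by positivity) hs0]
          nlinarith
  have hy0 : (1 - y) ≠ 0 := sub_ne_zero.mpr hy1.symm
  have := (hs.hasSum.tendsto_sum_nat.sub hlim).div_const (1 - y)
  rw [sub_zero] at this
  refine this.congr fun N => ?_
  rw [div_eq_iff hy0, mul_comm _ (1 - y), one_sub_mul_sum_range y (fun n => H k n / n) (by simp) N]
  rfl

/-- Superexponential decay in the depth, uniformly on `[-1, 0]`. -/
lemma partsSum_decay (h : IsNested η H H') (hη : |η| = 1) (hH : RapidDecay H)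
    (hH' : RapidDecay H') {τ : ℝ} (hτ : 0 < τ) :
    ∃ C, ∀ k, ∀ y ∈ Set.Icc (-1 : ℝ) 0, τ ^ k * |partsSum H k y| ≤ C := by
  obtain ⟨D, hD⟩ := h.coeffDiff_bound hη hH hH' hτ
  refine ⟨∑' n : ℕ, D * (1 / (n : ℝ) ^ (3 / 2 : ℝ)), fun k y hy => ?_⟩
  have hy1 : |y| ≤ 1 := abs_le.mpr ⟨hy.1, hy.2.trans zero_le_one⟩
  have h1 : τ ^ k * |partsSum H k y| ≤ |τ ^ k * ∑' n : ℕ, y ^ n * coeffDiff H k n| := by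
    rw [partsSum, abs_div, abs_mul, abs_of_pos (pow_pos hτ k)]
    gcongr
    refine div_le_self (abs_nonneg _) ?_
    rw [abs_of_nonneg] <;> linarith [hy.2]
  refine h1.trans ?_
  rw [← tsum_mul_left, ← Real.norm_eq_abs]
  refine tsum_of_norm_bounded (summable_rpow_bound D).hasSum fun n => ?_
  rw [norm_mul, norm_mul, norm_pow, norm_pow, Real.norm_of_nonneg hτ.le, Real.norm_eq_abs,
    Real.norm_eq_abs]
  refine le_trans ?_ (hD k n)
  gcongr
  exact mul_le_of_le_one_left (abs_nonneg _) (pow_le_one₀ (abs_nonneg _) hy1)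

lemma continuousOn_partsSum (h : IsNested η H H') (hη : |η| = 1) (hH : RapidDecay H)
    (hH' : RapidDecay H') (k : ℕ) : ContinuousOn (partsSum H k) (Set.Icc (-1 : ℝ) 0) := by
  obtain ⟨D, hD⟩ := h.coeffDiff_bound hη hH hH' one_pos
  refine ContinuousOn.div ?_ (by fun_prop) fun y hy => by linarith [hy.2]
  refine continuousOn_tsum (fun n => by fun_prop) (summable_rpow_bound D) fun n y hy => ?_
  have hy1 : |y| ≤ 1 := abs_le.mpr ⟨hy.1, hy.2.trans zero_le_one⟩
  have := hD k n
  rw [one_pow, one_mul] at this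
  rw [norm_mul, norm_pow, Real.norm_eq_abs, Real.norm_eq_abs]
  exact (mul_le_of_le_one_left (abs_nonneg _) (pow_le_one₀ (abs_nonneg _) hy1)).trans this

/-- The continuous extension of `nestedSeries` to the closed interval `[-1, 0]`. -/
noncomputable def closedSeries (H : ℕ → ℕ → ℝ) (t : ℂ) (y : ℝ) : ℂ :=
  1 + t * ∑' k : ℕ, t ^ k * (partsSum H k y : ℂ)

lemma summable_partsSum (h : IsNested η H H') (hη : |η| = 1) (hH : RapidDecay H)
    (hH' : RapidDecay H') (t : ℂ) {y : ℝ} (hy : y ∈ Set.Icc (-1 : ℝ) 0) :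
    Summable fun k : ℕ => t ^ k * (partsSum H k y : ℂ) := by
  refine summable_of_rapid_decay (fun τ hτ => ?_) t
  obtain ⟨C, hC⟩ := partsSum_decay h hη hH hH' hτ
  exact ⟨C, fun k => by simpa using hC k y hy⟩

lemma differentiable_closedSeries (h : IsNested η H H') (hη : |η| = 1) (hH : RapidDecay H)
    (hH' : RapidDecay H') {y : ℝ} (hy : y ∈ Set.Icc (-1 : ℝ) 0) :
    Differentiable ℂ fun t => closedSeries H t y := by
  refine (differentiable_id.mul (differentiable_of_rapid_decay fun τ hτ => ?_)).const_add 1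
  obtain ⟨C, hC⟩ := partsSum_decay h hη hH hH' hτ
  exact ⟨C, fun k => by simpa using hC k y hy⟩

lemma continuousOn_closedSeries (h : IsNested η H H') (hη : |η| = 1) (hH : RapidDecay H)
    (hH' : RapidDecay H') (t : ℂ) : ContinuousOn (closedSeries H t) (Set.Icc (-1 : ℝ) 0) := by
  obtain ⟨C, hC⟩ := partsSum_decay h hη hH hH' (τ := 2 * (‖t‖ + 1)) (by positivity)
  refine continuousOn_const.add (continuousOn_const.mul ?_)
  refine continuousOn_tsum (u := fun k => C * (1 / 2) ^ k)
    (fun k => continuousOn_const.mul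
      (Complex.continuous_ofReal.comp_continuousOn (continuousOn_partsSum h hη hH hH' k)))
    (summable_geometric_two.mul_left C) fun k y hy => ?_
  rw [norm_mul, norm_pow, Complex.norm_real, Real.norm_eq_abs]
  exact pow_mul_le_geometric (abs_nonneg _) (norm_nonneg _) (hC k y hy)

/-- Absolute convergence, inside the unit interval, of the double series over the depth and the
outermost summation variable. -/
lemma RapidDecay.summable_prod (hH : RapidDecay H) (t : ℂ) {y : ℝ} (hy : |y| < 1) :
    Summable (Function.uncurry fun n k : ℕ => (y : ℂ) ^ n * (t ^ k * (H k n : ℂ) / n)) := by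
  obtain ⟨C, hC0, hC⟩ := hH.geometric_bound t
  have hs := (summable_linear_mul_pow C (abs_nonneg y) hy).mul_of_nonneg summable_geometric_two
    (fun n => mul_nonneg (by positivity) (by positivity)) (fun n => by positivity)
  refine Summable.of_norm_bounded hs ?_
  rintro ⟨n, k⟩
  have h1 : ‖t ^ k * (H k n : ℂ) / n‖ ≤ ‖t ^ k * (H k n : ℂ)‖ := by
    rw [norm_div, Complex.norm_natCast]
    rcases n with _ | n
    · simpa using norm_nonneg (t ^ k * (H k 0 : ℂ))
    · exact div_le_self (norm_nonneg _) (by push_cast; linarith [Nat.cast_nonneg (α := ℝ) n])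
  rw [Function.uncurry_apply_pair, norm_mul, norm_pow, Complex.norm_real, Real.norm_eq_abs]
  calc |y| ^ n * ‖t ^ k * (H k n : ℂ) / n‖
      ≤ |y| ^ n * (C * ((n : ℝ) + 1) * (1 / 2) ^ k) :=
        mul_le_mul_of_nonneg_left (h1.trans (hC k n)) (by positivity)
    _ = C * ((n : ℝ) + 1) * |y| ^ n * (1 / 2) ^ k := by ring

lemma mul_partsSum_eq_tsum (h : IsNested η H H') (hη : |η| = 1) (hH : RapidDecay H)
    (hH' : RapidDecay H') (t : ℂ) {y : ℝ} (hy : |y| < 1) (k : ℕ) :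
    t ^ k * (partsSum H k y : ℂ) = ∑' n : ℕ, (y : ℂ) ^ n * (t ^ k * (H k n : ℂ) / n) := by
  have hlim := tendsto_sum_range_partsSum h hη hH hH' k hy.le (lt_of_abs_lt hy).ne
  have hlim' := ((Complex.continuous_ofReal.tendsto _).comp hlim).const_mul (t ^ k)
  have hs : Summable fun n : ℕ => (y : ℂ) ^ n * (t ^ k * (H k n : ℂ) / n) :=
    (hH.summable_prod t hy).prod_symm.prod_factor k
  refine tendsto_nhds_unique hlim' (hs.hasSum.tendsto_sum_nat.congr fun N => ?_)
  simp only [Function.comp_apply, Complex.ofReal_sum, Finset.mul_sum]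
  refine Finset.sum_congr rfl fun n _ => ?_
  push_cast
  ring

lemma closedSeries_eq_nestedSeries (h : IsNested η H H') (hη : |η| = 1) (hH : RapidDecay H)
    (hH' : RapidDecay H') (t : ℂ) {y : ℝ} (hy : |y| < 1) :
    closedSeries H t y = nestedSeries H t y := by
  have hsum := (hH.summable_prod t hy).tsum_comm
  have hn : ∀ n : ℕ, ∑' k : ℕ, (y : ℂ) ^ n * (t ^ k * (H k n : ℂ) / n)
      = (y : ℂ) ^ n * (depthGen H t n / n) := by
    intro n
    rw [depthGen, tsum_mul_left, tsum_div_const]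
  rw [closedSeries, nestedSeries, logSeries,
    tsum_congr fun k => mul_partsSum_eq_tsum h hη hH hH' t hy k, hsum, tsum_congr hn]

/-! ### Growth of nested alternating sums -/

/-- Two successive recursion steps, merged so that contributions of opposite sign cancel. -/
lemma IsNested.two_steps {θ : ℝ} (h : IsNested η H H') (h' : IsNested θ H' H) (k N : ℕ) :
    H (k + 2) (N + 2) = H (k + 2) N + (η ^ N / N + η ^ (N + 1) / (N + 1)) * H' (k + 1) N
      + η ^ (N + 1) * θ ^ N / (N * (N + 1)) * H k N := by
  rw [h.step (k + 1) (N + 1), h.step (k + 1) N, h'.step k N]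
  simp only [div_eq_mul_inv, mul_inv]
  push_cast
  ring

lemma IsNested.two_steps_bound {θ : ℝ} (h : IsNested η H H') (h' : IsNested θ H' H)
    (hη : |η| = 1) (hθ : |θ| = 1) {τ a b : ℝ} (hτ : 0 < τ) {N : ℕ}
    (ha : ∀ k, τ ^ k * |H k N| ≤ a) (hb : ∀ k, τ ^ k * |H' k N| ≤ b) (k : ℕ) :
    τ ^ k * |H k (N + 2)| ≤
      a + |η ^ N / N + η ^ (N + 1) / (N + 1)| * τ * b + τ ^ 2 / (N * (N + 1)) * a := by
  have ha0 : 0 ≤ a := (by positivity : 0 ≤ τ ^ 0 * |H 0 N|).trans (ha 0)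
  have hb0 : 0 ≤ b := (by positivity : 0 ≤ τ ^ 0 * |H' 0 N|).trans (hb 0)
  set α := η ^ N / N + η ^ (N + 1) / (N + 1) with hα
  have hp1 : 0 ≤ |α| * τ * b := by positivity
  have hp2 : 0 ≤ τ ^ 2 / (N * (N + 1)) * a := by positivity
  rcases k with _ | _ | k
  · have := ha 0
    rw [h.depth_zero] at this ⊢
    refine this.trans ?_
    rw [add_assoc]
    exact le_add_of_nonneg_right (add_nonneg hp1 hp2)
  · have e : H 1 (N + 2) = H 1 N + α * H' 0 N := by
      have e1 := h.step 0 (N + 1)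
      have e2 := h.step 0 N
      rw [h'.depth_zero] at *
      rw [zero_add] at e1 e2
      rw [e1, e2, hα]
      push_cast
      ring
    have h1 := ha 1
    have h2 := hb 0
    rw [pow_zero, one_mul] at h2
    rw [zero_add, pow_one, e]
    rw [pow_one] at h1
    calc τ * |H 1 N + α * H' 0 N| ≤ τ * (|H 1 N| + |α| * |H' 0 N|) := by
          gcongr
          rw [← abs_mul]
          exact abs_add_le _ _
      _ = τ * |H 1 N| + |α| * τ * |H' 0 N| := by ring
      _ ≤ a + |α| * τ * b := by gcongr
      _ ≤ _ := by linarith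
  · have hβ : |η ^ (N + 1) * θ ^ N / (N * (N + 1))| = 1 / ((N : ℝ) * (N + 1)) := by
      rw [abs_div, abs_mul, abs_pow, abs_pow, hη, hθ, one_pow, one_pow, one_mul,
        abs_of_nonneg (by positivity : (0 : ℝ) ≤ (N : ℝ) * (N + 1))]
    have h1 := ha (k + 2)
    have h2 := hb (k + 1)
    have h3 := ha k
    rw [h.two_steps h', ← hα]
    calc τ ^ (k + 2) * |H (k + 2) N + α * H' (k + 1) N
          + η ^ (N + 1) * θ ^ N / (N * (N + 1)) * H k N|
        ≤ τ ^ (k + 2) * (|H (k + 2) N| + |α| * |H' (k + 1) N|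
          + 1 / ((N : ℝ) * (N + 1)) * |H k N|) := by
          gcongr
          refine (abs_add_three _ _ _).trans (le_of_eq ?_)
          rw [abs_mul, abs_mul, hβ]
      _ = τ ^ (k + 2) * |H (k + 2) N| + |α| * τ * (τ ^ (k + 1) * |H' (k + 1) N|)
          + τ ^ 2 / (N * (N + 1)) * (τ ^ k * |H k N|) := by ring
      _ ≤ _ := by gcongr

lemma IsNested.bound_at_zero (h : IsNested η H H') (τ : ℝ) (k : ℕ) : τ ^ k * |H k 0| ≤ 1 := by
  rcases k with _ | k
  · simp [h.depth_zero]
  · simp [h.trunc_zero]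

lemma IsNested.bound_at_one (h : IsNested η H H') (τ : ℝ) (k : ℕ) : τ ^ k * |H k 1| ≤ 1 := by
  rcases k with _ | k
  · simp [h.depth_zero]
  · have := h.step k 0
    simp [h.trunc_zero] at this
    simp [this]

lemma IsNested.one_step_bound (h : IsNested η H H') (hη : |η| = 1) {τ a b : ℝ} (hτ : 0 < τ)
    {N : ℕ} (hN : 0 < N) (ha : ∀ k, τ ^ k * |H k N| ≤ a) (hb : ∀ k, τ ^ k * |H' k N| ≤ b)
    (k : ℕ) : τ ^ k * |H k (N + 1)| ≤ a + τ * b := by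
  have hb0 : 0 ≤ b := (by positivity : 0 ≤ τ ^ 0 * |H' 0 N|).trans (hb 0)
  rcases k with _ | k
  · have := ha 0
    rw [h.depth_zero] at this ⊢
    have : 0 ≤ τ * b := by positivity
    linarith
  · have h1 := ha (k + 1)
    have h2 := hb k
    have h3 : |η ^ N / (N : ℝ)| ≤ 1 := by
      rw [abs_div, abs_pow, hη, one_pow, Nat.abs_cast]
      exact (div_le_one (by exact_mod_cast hN)).mpr (by exact_mod_cast hN)
    rw [h.step]
    calc τ ^ (k + 1) * |H (k + 1) N + η ^ N / N * H' k N|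
        ≤ τ ^ (k + 1) * (|H (k + 1) N| + 1 * |H' k N|) := by
          gcongr
          refine (abs_add_le _ _).trans ?_
          rw [abs_mul]
          gcongr
      _ = τ ^ (k + 1) * |H (k + 1) N| + τ * (τ ^ k * |H' k N|) := by ring
      _ ≤ _ := by gcongr

/-- The majorant `∏_{j<n} (1 + c (j + 1)⁻³ᐟ²)`. -/
noncomputable def majorant (c : ℝ) (n : ℕ) : ℝ :=
  ∏ j ∈ Finset.range n, (1 + c * (1 / √((j : ℝ) + 1) ^ 3))

lemma majorant_succ (c : ℝ) (n : ℕ) :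
    majorant c (n + 1) = majorant c n * (1 + c * (1 / √((n : ℝ) + 1) ^ 3)) :=
  Finset.prod_range_succ _ _

lemma one_le_majorant {c : ℝ} (hc : 0 ≤ c) (n : ℕ) : 1 ≤ majorant c n := by
  induction n with
  | zero => simp [majorant]
  | succ n ih =>
    rw [majorant_succ]
    exact one_le_mul_of_one_le_of_one_le ih (le_add_of_nonneg_right (by positivity))

lemma exists_majorant_le {c : ℝ} (hc : 0 ≤ c) : ∃ B, ∀ n, majorant c n ≤ B := by
  have hs : Summable fun j : ℕ => c * (1 / √((j : ℝ) + 1) ^ 3) := by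
    refine Summable.mul_left c ?_
    have := (summable_nat_add_iff 1).mpr
      (Real.summable_one_div_nat_rpow (p := 3 / 2).mpr (by norm_num))
    refine this.congr fun n => ?_
    have h0 : (0 : ℝ) ≤ (n : ℝ) + 1 := by positivity
    rw [Real.sqrt_eq_rpow, ← Real.rpow_natCast (((n : ℝ) + 1) ^ (1 / 2 : ℝ)), ← Real.rpow_mul h0]
    push_cast
    norm_num
  refine ⟨Real.exp (∑' j : ℕ, c * (1 / √((j : ℝ) + 1) ^ 3)), fun n => ?_⟩
  calc majorant c n ≤ ∏ j ∈ Finset.range n, Real.exp (c * (1 / √((j : ℝ) + 1) ^ 3)) := by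
        refine Finset.prod_le_prod (fun j _ => by positivity) fun j _ => ?_
        rw [add_comm]
        exact Real.add_one_le_exp _
    _ = Real.exp (∑ j ∈ Finset.range n, c * (1 / √((j : ℝ) + 1) ^ 3)) := (Real.exp_sum _ _).symm
    _ ≤ _ := Real.exp_le_exp.mpr (hs.sum_le_tsum _ fun j _ => by positivity)

/-- The cancellation between the two signs at `2n + 1` and `2n + 2`. -/
lemma abs_alternating_pair (n : ℕ) :
    |(-1 : ℝ) ^ (2 * n + 1) / ((2 * n + 1 : ℕ) : ℝ)
      + (-1) ^ (2 * n + 1 + 1) / (((2 * n + 1 : ℕ) : ℝ) + 1)|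
      = 1 / (((2 * n + 1 : ℕ) : ℝ) * (((2 * n + 1 : ℕ) : ℝ) + 1)) := by
  have h1 : (-1 : ℝ) ^ (2 * n + 1) = -1 := Odd.neg_one_pow ⟨n, rfl⟩
  have h2 : (-1 : ℝ) ^ (2 * n + 1 + 1) = 1 := Even.neg_one_pow ⟨n + 1, by ring⟩
  rw [h1, h2]
  set N : ℝ := ((2 * n + 1 : ℕ) : ℝ)
  have hN : 0 < N := by positivity
  have : -1 / N + 1 / (N + 1) = -(1 / (N * (N + 1))) := by
    field_simp
    ring
  rw [this, abs_neg, abs_of_pos (by positivity)]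

lemma one_le_sqrt_and_sq_sqrt (n : ℕ) : 1 ≤ √((n : ℝ) + 1) ∧ √((n : ℝ) + 1) ^ 2 = (n : ℝ) + 1 :=
  ⟨Real.one_le_sqrt.mpr (by linarith [Nat.cast_nonneg (α := ℝ) n]), Real.sq_sqrt (by positivity)⟩

lemma one_div_mul_succ_le (n : ℕ) :
    1 / (((2 * n + 1 : ℕ) : ℝ) * (((2 * n + 1 : ℕ) : ℝ) + 1)) ≤ 1 / √((n : ℝ) + 1) ^ 4 := by
  obtain ⟨h1, h2⟩ := one_le_sqrt_and_sq_sqrt n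
  have : √((n : ℝ) + 1) ^ 4 = (√((n : ℝ) + 1) ^ 2) ^ 2 := by ring
  rw [this, h2]
  push_cast
  have hn : (0 : ℝ) ≤ n := Nat.cast_nonneg n
  exact one_div_le_one_div_of_le (by positivity) (by nlinarith)

/-- Sums over alternating signs `1̄, 1, 1̄, …`: those starting with `1̄` stay bounded along odd
truncation bounds, those starting with `1` grow slower than `√n`. -/
lemma alternating_odd_bound (h : IsNested (-1) H H') (h' : IsNested 1 H' H) {τ : ℝ} (hτ : 0 < τ)
    (n : ℕ) :
    (∀ k, τ ^ k * |H k (2 * n + 1)| ≤ majorant (2 * τ + τ ^ 2) n) ∧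
      ∀ k, τ ^ k * |H' k (2 * n + 1)| ≤ majorant (2 * τ + τ ^ 2) n * √((n : ℝ) + 1) := by
  induction n with
  | zero => simpa [majorant] using ⟨h.bound_at_one τ, h'.bound_at_one τ⟩
  | succ n ih =>
    obtain ⟨ih1, ih2⟩ := ih
    have hA : 1 ≤ majorant (2 * τ + τ ^ 2) n := one_le_majorant (by positivity) n
    obtain ⟨hs1, hs2⟩ := one_le_sqrt_and_sq_sqrt n
    have hpair := one_div_mul_succ_le n
    have hmono : √((n : ℝ) + 1) ≤ √(((n + 1 : ℕ) : ℝ) + 1) :=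
      Real.sqrt_le_sqrt (by push_cast; linarith)
    set A := majorant (2 * τ + τ ^ 2) n
    set s := √((n : ℝ) + 1)
    have hs0 : 0 < s := by linarith
    have hq : 1 / s ^ 4 ≤ 1 / s ^ 3 :=
      one_div_le_one_div_of_le (by positivity) (pow_le_pow_right₀ hs1 (by norm_num))
    rw [majorant_succ]
    refine ⟨fun k => ?_, fun k => ?_⟩
    · have key := h.two_steps_bound h' (by norm_num) (by norm_num) hτ ih1 ih2 k
      rw [abs_alternating_pair] at key
      refine key.trans ?_
      rw [← mul_one_div (τ ^ 2)]
      have hp := hpair.trans hq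
      have hp' := hpair
      generalize 1 / (((2 * n + 1 : ℕ) : ℝ) * (((2 * n + 1 : ℕ) : ℝ) + 1)) = p at hp hp' ⊢
      calc _ ≤ A + 1 / s ^ 4 * τ * (A * s) + τ ^ 2 * (1 / s ^ 3) * A := by
            gcongr
        _ = A + (τ + τ ^ 2) * A * (1 / s ^ 3) := by
            field_simp
            ring
        _ ≤ A + (2 * τ + τ ^ 2) * A * (1 / s ^ 3) := by
            gcongr
            linarith
        _ = _ := by ring
    · have key := h'.two_steps_bound h (by norm_num) (by norm_num) hτ ih2 ih1 k
      refine key.trans ?_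
      have hα : |(1 : ℝ) ^ (2 * n + 1) / ((2 * n + 1 : ℕ) : ℝ)
          + 1 ^ (2 * n + 1 + 1) / (((2 * n + 1 : ℕ) : ℝ) + 1)| ≤ 2 / s ^ 2 := by
        rw [hs2, one_pow, one_pow, abs_of_nonneg (by positivity)]
        have e1 : 1 / ((2 * n + 1 : ℕ) : ℝ) ≤ 1 / ((n : ℝ) + 1) :=
          one_div_le_one_div_of_le (by positivity)
            (by push_cast; linarith [Nat.cast_nonneg (α := ℝ) n])
        have e2 : 1 / (((2 * n + 1 : ℕ) : ℝ) + 1) ≤ 1 / ((n : ℝ) + 1) :=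
          one_div_le_one_div_of_le (by positivity)
            (by push_cast; linarith [Nat.cast_nonneg (α := ℝ) n])
        have e3 : (2 : ℝ) / ((n : ℝ) + 1) = 1 / ((n : ℝ) + 1) + 1 / ((n : ℝ) + 1) := by ring
        rw [e3]
        exact add_le_add e1 e2
      rw [← mul_one_div (τ ^ 2)]
      have hp := hpair.trans hq
      generalize 1 / (((2 * n + 1 : ℕ) : ℝ) * (((2 * n + 1 : ℕ) : ℝ) + 1)) = p at hp ⊢
      calc _ ≤ A * s + 2 / s ^ 2 * τ * A + τ ^ 2 * (1 / s ^ 3) * (A * s) := by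
            gcongr
        _ = A * (1 + (2 * τ + τ ^ 2) * (1 / s ^ 3)) * s := by
            field_simp
            ring
        _ ≤ _ := by gcongr

/-- Sums over the words `{1̄}ᵏ` stay bounded along odd truncation bounds. -/
lemma self_odd_bound (h : IsNested (-1) H H) {τ : ℝ} (hτ : 0 < τ) (n k : ℕ) :
    τ ^ k * |H k (2 * n + 1)| ≤ majorant (τ + τ ^ 2) n := by
  induction n generalizing k with
  | zero => simpa [majorant] using h.bound_at_one τ k
  | succ n ih =>
    have hA : 1 ≤ majorant (τ + τ ^ 2) n := one_le_majorant (by positivity) n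
    obtain ⟨hs1, hs2⟩ := one_le_sqrt_and_sq_sqrt n
    have hpair := one_div_mul_succ_le n
    set A := majorant (τ + τ ^ 2) n
    set s := √((n : ℝ) + 1)
    have hs0 : 0 < s := by linarith
    have hq : 1 / s ^ 4 ≤ 1 / s ^ 3 :=
      one_div_le_one_div_of_le (by positivity) (pow_le_pow_right₀ hs1 (by norm_num))
    have key := h.two_steps_bound h (by norm_num) (by norm_num) hτ ih ih k
    rw [abs_alternating_pair, ← mul_one_div (τ ^ 2)] at key
    rw [majorant_succ]
    refine key.trans ?_
    have hp := hpair.trans hq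
    generalize 1 / (((2 * n + 1 : ℕ) : ℝ) * (((2 * n + 1 : ℕ) : ℝ) + 1)) = p at hp ⊢
    calc _ ≤ A + 1 / s ^ 3 * τ * A + τ ^ 2 * (1 / s ^ 3) * A := by
          gcongr
      _ = _ := by ring

lemma alternating_rapidDecay (h : IsNested (-1) H H') (h' : IsNested 1 H' H) :
    RapidDecay H ∧ RapidDecay H' := by
  have main : ∀ τ : ℝ, 0 < τ → ∃ C, ∀ k n, τ ^ k * |H k n| ≤ C * √((n : ℝ) + 1) ∧
      τ ^ k * |H' k n| ≤ C * √((n : ℝ) + 1) := by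
    intro τ hτ
    obtain ⟨B, hB⟩ := exists_majorant_le (c := 2 * τ + τ ^ 2) (by positivity)
    have hB1 : 1 ≤ B := (one_le_majorant (by positivity) 0).trans (hB 0)
    refine ⟨B * (1 + τ), fun k n => ?_⟩
    have hBτ : B ≤ B * (1 + τ) := by nlinarith
    have hs1 : 1 ≤ √((n : ℝ) + 1) := (one_le_sqrt_and_sq_sqrt n).1
    obtain ⟨m, rfl | rfl⟩ := n.even_or_odd'
    · rcases m with _ | m
      · have : 1 ≤ B * (1 + τ) := hB1.trans hBτ
        simpa using ⟨(h.bound_at_zero τ k).trans this, (h'.bound_at_zero τ k).trans this⟩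
      · obtain ⟨b1, b2⟩ := alternating_odd_bound h h' hτ m
        have hAB := hB m
        have hA := one_le_majorant (c := 2 * τ + τ ^ 2) (by positivity) m
        have hm1 := (one_le_sqrt_and_sq_sqrt m).1
        have hm : √((m : ℝ) + 1) ≤ √(((2 * (m + 1) : ℕ) : ℝ) + 1) :=
          Real.sqrt_le_sqrt (by push_cast; linarith [Nat.cast_nonneg (α := ℝ) m])
        have e : 2 * (m + 1) = 2 * m + 1 + 1 := by ring
        have c1 := h.one_step_bound (by norm_num) hτ (by omega) b1 b2 k
        have c2 := h'.one_step_bound (by norm_num) hτ (by omega) b2 b1 k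
        rw [← e] at c1 c2
        set A := majorant (2 * τ + τ ^ 2) m
        have hAs : A ≤ A * √((m : ℝ) + 1) := le_mul_of_one_le_right (by linarith) hm1
        have hτA : τ * A ≤ τ * (A * √((m : ℝ) + 1)) := by gcongr
        have fin : A * √((m : ℝ) + 1) * (1 + τ)
            ≤ B * (1 + τ) * √(((2 * (m + 1) : ℕ) : ℝ) + 1) := by
          rw [mul_right_comm]
          gcongr
        exact ⟨by linarith, by linarith⟩
    · obtain ⟨b1, b2⟩ := alternating_odd_bound h h' hτ m
      have hA := one_le_majorant (c := 2 * τ + τ ^ 2) (by positivity) m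
      have hm1 := (one_le_sqrt_and_sq_sqrt m).1
      have hm : √((m : ℝ) + 1) ≤ √(((2 * m + 1 : ℕ) : ℝ) + 1) :=
        Real.sqrt_le_sqrt (by push_cast; linarith [Nat.cast_nonneg (α := ℝ) m])
      have fin : majorant (2 * τ + τ ^ 2) m * √((m : ℝ) + 1)
          ≤ B * (1 + τ) * √(((2 * m + 1 : ℕ) : ℝ) + 1) := by
        gcongr
        exact (hB m).trans hBτ
      exact ⟨((b1 k).trans (le_mul_of_one_le_right (by linarith) hm1)).trans fin,
        (b2 k).trans fin⟩
  refine ⟨fun τ hτ => ?_, fun τ hτ => ?_⟩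
  · obtain ⟨C, hC⟩ := main τ hτ
    exact ⟨C, fun k n => (hC k n).1⟩
  · obtain ⟨C, hC⟩ := main τ hτ
    exact ⟨C, fun k n => (hC k n).2⟩

lemma self_bounded (h : IsNested (-1) H H) {τ : ℝ} (hτ : 0 < τ) :
    ∃ C, ∀ k n, τ ^ k * |H k n| ≤ C := by
  obtain ⟨B, hB⟩ := exists_majorant_le (c := τ + τ ^ 2) (by positivity)
  have hB1 : 1 ≤ B := (one_le_majorant (by positivity) 0).trans (hB 0)
  have hBτ : B ≤ B + τ * B := le_add_of_nonneg_right (by positivity)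
  refine ⟨B + τ * B, fun k n => ?_⟩
  obtain ⟨m, rfl | rfl⟩ := n.even_or_odd'
  · rcases m with _ | m
    · exact (h.bound_at_zero τ k).trans (hB1.trans hBτ)
    · have b : ∀ k, τ ^ k * |H k (2 * m + 1)| ≤ B := fun k => (self_odd_bound h hτ m k).trans (hB m)
      exact h.one_step_bound (by norm_num) hτ (by omega) b b k
  · exact ((self_odd_bound h hτ m k).trans (hB m)).trans hBτ

lemma self_rapidDecay (h : IsNested (-1) H H) : RapidDecay H := by
  intro τ hτ
  obtain ⟨C, hC⟩ := self_bounded h hτ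
  refine ⟨C, fun k n => (hC k n).trans ?_⟩
  have hC0 : 0 ≤ C := (by positivity : 0 ≤ τ ^ 0 * |H 0 0|).trans (hC 0 0)
  exact le_mul_of_one_le_right hC0 (one_le_sqrt_and_sq_sqrt n).1

/-! ### The alternating words and the words `{1̄}ⁿ` -/

/-- The word `s, -s, s, …` of length `k`. -/
def altWord : ℤ → ℕ → List ℤ
  | _, 0 => []
  | s, k + 1 => s :: altWord (-s) k

/-- The truncated sums at `x = 1` of the words `s, -s, s, …`, indexed by depth. -/
noncomputable def altSums (s : ℤ) (k n : ℕ) : ℝ := zetaTrunc 1 (altWord s k) n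

/-- The truncated sums at `x = 1` of the words `{1̄}ᵏ`, indexed by depth. -/
noncomputable def barSums (k n : ℕ) : ℝ := zetaTrunc 1 (wordBar k) n

lemma wordEven_eq_altWord (n : ℕ) : wordEven n = altWord (-1) (2 * n) := by
  induction n with
  | zero => rfl
  | succ n ih =>
    rw [wordEven, List.replicate_succ, List.flatten_cons, ← wordEven, ih]
    rfl

lemma wordOdd_eq_altWord (n : ℕ) : wordOdd n = altWord (-1) (2 * n + 1) := by
  have : ∀ n : ℕ, (List.replicate n [(1 : ℤ), -1]).flatten = altWord 1 (2 * n) := by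
    intro n
    induction n with
    | zero => rfl
    | succ n ih =>
      rw [List.replicate_succ, List.flatten_cons, ih]
      rfl
  rw [wordOdd, this]
  rfl

lemma zetaTrunc_one_cons_succ {s : ℤ} (hs : s.natAbs = 1) (l : List ℤ) (n : ℕ) :
    zetaTrunc 1 (s :: l) (n + 1)
      = zetaTrunc 1 (s :: l) n + (s.sign : ℝ) ^ n / n * zetaTrunc 1 l n := by
  rcases n with _ | n
  · simp [zetaTrunc]
  · rw [zetaTrunc, zetaTrunc, Finset.sum_Ico_succ_top (by omega), hs]
    simp

lemma zetaTrunc_cons_zero (x : ℝ) (s : ℤ) (l : List ℤ) : zetaTrunc x (s :: l) 0 = 0 := by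
  simp [zetaTrunc]

lemma cast_sign_neg_one : (((-1 : ℤ).sign : ℤ) : ℝ) = -1 := by simp

lemma isNested_altSums_neg_one : IsNested (-1) (altSums (-1)) (altSums 1) where
  depth_zero _ := rfl
  trunc_zero _ := zetaTrunc_cons_zero _ _ _
  step k n := by
    have := zetaTrunc_one_cons_succ (s := -1) rfl (altWord 1 k) n
    rw [cast_sign_neg_one] at this
    exact this

lemma isNested_altSums_one : IsNested 1 (altSums 1) (altSums (-1)) where
  depth_zero _ := rfl
  trunc_zero _ := zetaTrunc_cons_zero _ _ _
  step k n := by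
    have := zetaTrunc_one_cons_succ (s := 1) rfl (altWord (-1) k) n
    rw [Int.sign_one, Int.cast_one] at this
    exact this

lemma isNested_barSums : IsNested (-1) barSums barSums where
  depth_zero _ := rfl
  trunc_zero _ := zetaTrunc_cons_zero _ _ _
  step k n := by
    have := zetaTrunc_one_cons_succ (s := -1) rfl (wordBar k) n
    rw [cast_sign_neg_one] at this
    exact this

lemma rapidDecay_altSums_neg_one : RapidDecay (altSums (-1)) :=
  (alternating_rapidDecay isNested_altSums_neg_one isNested_altSums_one).1

lemma rapidDecay_altSums_one : RapidDecay (altSums 1) :=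
  (alternating_rapidDecay isNested_altSums_neg_one isNested_altSums_one).2

lemma rapidDecay_barSums : RapidDecay barSums := self_rapidDecay isNested_barSums

/-- The outermost sign is absorbed into `x`. -/
lemma zetaTrunc_bar_cons (x : ℝ) (l : List ℤ) (N : ℕ) :
    zetaTrunc x (-1 :: l) N = ∑ n ∈ Finset.range N, (-x) ^ n * (zetaTrunc 1 l n / n) := by
  rw [zetaTrunc]
  have hterm : ∀ n : ℕ, x ^ n * ((((-1 : ℤ).sign : ℤ) : ℝ) ^ n / (n : ℝ) ^ (-1 : ℤ).natAbs)
      * zetaTrunc 1 l n = (-x) ^ n * (zetaTrunc 1 l n / n) := by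
    intro n
    have h2 : (-1 : ℤ).natAbs = 1 := rfl
    rw [cast_sign_neg_one, h2, pow_one, neg_pow x]
    ring
  rw [Finset.sum_congr rfl fun n _ => hterm n]
  refine Finset.sum_subset (fun n hn => ?_) fun n hn hn' => ?_
  · exact Finset.mem_range.mpr (Finset.mem_Ico.mp hn).2
  · have : n = 0 := by
      rw [Finset.mem_range] at hn
      rw [Finset.mem_Ico] at hn'
      omega
    simp [this]

lemma tendsto_zetaTrunc_altWord {x : ℝ} (hx0 : 0 ≤ x) (hx1 : x ≤ 1) (k : ℕ) :
    Tendsto (zetaTrunc x (altWord (-1) (k + 1))) atTop (𝓝 (partsSum (altSums 1) k (-x))) :=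
  (tendsto_sum_range_partsSum isNested_altSums_one (by norm_num) rapidDecay_altSums_one
    rapidDecay_altSums_neg_one k (by rwa [abs_neg, abs_of_nonneg hx0])
    (by linarith)).congr fun N => (zetaTrunc_bar_cons x _ N).symm

lemma tendsto_zetaTrunc_wordBar (k : ℕ) :
    Tendsto (zetaTrunc 1 (wordBar (k + 1))) atTop (𝓝 (partsSum barSums k (-1))) :=
  (tendsto_sum_range_partsSum isNested_barSums (by norm_num) rapidDecay_barSums
    rapidDecay_barSums k (by norm_num) (by norm_num)).congr
      fun N => (zetaTrunc_bar_cons 1 _ N).symm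

lemma zetaX_nil (x : ℝ) : zetaX x [] = 1 :=
  (tendsto_const_nhds (x := (1 : ℝ))).limUnder_eq

lemma zetaX_altWord_succ {x : ℝ} (hx0 : 0 ≤ x) (hx1 : x ≤ 1) (k : ℕ) :
    zetaX x (altWord (-1) (k + 1)) = partsSum (altSums 1) k (-x) :=
  (tendsto_zetaTrunc_altWord hx0 hx1 k).limUnder_eq

lemma zetaX_wordBar_succ (k : ℕ) : zetaX 1 (wordBar (k + 1)) = partsSum barSums k (-1) :=
  (tendsto_zetaTrunc_wordBar k).limUnder_eq

lemma tendsto_zetaX_altWord {x : ℝ} (hx0 : 0 ≤ x) (hx1 : x ≤ 1) (k : ℕ) :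
    Tendsto (zetaTrunc x (altWord (-1) k)) atTop (𝓝 (zetaX x (altWord (-1) k))) := by
  rcases k with _ | k
  · rw [altWord, zetaX_nil]
    exact tendsto_const_nhds
  · rw [zetaX_altWord_succ hx0 hx1]
    exact tendsto_zetaTrunc_altWord hx0 hx1 k

lemma tendsto_zetaX_wordBar (k : ℕ) :
    Tendsto (zetaTrunc 1 (wordBar k)) atTop (𝓝 (zetaX 1 (wordBar k))) := by
  rcases k with _ | k
  · rw [wordBar, List.replicate_zero, zetaX_nil]
    exact tendsto_const_nhds
  · rw [zetaX_wordBar_succ]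
    exact tendsto_zetaTrunc_wordBar k

lemma neg_mem_Icc {x : ℝ} (hx0 : 0 ≤ x) (hx1 : x ≤ 1) : -x ∈ Set.Icc (-1 : ℝ) 0 :=
  ⟨by linarith, by linarith⟩

lemma hasSum_closedSeries {H : ℕ → ℕ → ℝ} {c : ℕ → ℝ} {t : ℂ} {y : ℝ} (h0 : c 0 = 1)
    (hc : ∀ k, c (k + 1) = partsSum H k y)
    (hs : Summable fun k : ℕ => t ^ k * (partsSum H k y : ℂ)) :
    HasSum (fun k : ℕ => t ^ k * (c k : ℂ)) (closedSeries H t y) := by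
  rw [← hasSum_nat_add_iff' 1]
  have e1 : (fun k : ℕ => t * (t ^ k * (partsSum H k y : ℂ)))
      = fun k : ℕ => t ^ (k + 1) * (c (k + 1) : ℂ) := by
    funext k
    rw [hc]
    ring
  have e2 : t * ∑' k : ℕ, t ^ k * (partsSum H k y : ℂ)
      = closedSeries H t y - ∑ k ∈ Finset.range 1, t ^ k * (c k : ℂ) := by
    simp [closedSeries, h0]
  have := hs.hasSum.mul_left t
  rw [e1, e2] at this
  exact this

lemma hasSum_altWord {x : ℝ} (hx0 : 0 ≤ x) (hx1 : x ≤ 1) (t : ℂ) :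
    HasSum (fun k : ℕ => t ^ k * (zetaX x (altWord (-1) k) : ℂ))
      (closedSeries (altSums 1) t (-x)) :=
  hasSum_closedSeries (zetaX_nil x) (zetaX_altWord_succ hx0 hx1)
    (summable_partsSum isNested_altSums_one (by norm_num) rapidDecay_altSums_one
      rapidDecay_altSums_neg_one t (neg_mem_Icc hx0 hx1))

lemma hasSum_wordBar (z : ℂ) :
    HasSum (fun k : ℕ => z ^ k * (zetaX 1 (wordBar k) : ℂ)) (closedSeries barSums z (-1)) :=
  hasSum_closedSeries (zetaX_nil 1) zetaX_wordBar_succ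
    (summable_partsSum isNested_barSums (by norm_num) rapidDecay_barSums
      rapidDecay_barSums z (by norm_num))

lemma A_eq_closedSeries (z : ℂ) : A z = closedSeries barSums z (-1) := (hasSum_wordBar z).tsum_eq

lemma summable_even {x : ℝ} (hx0 : 0 ≤ x) (hx1 : x ≤ 1) (t : ℂ) :
    Summable fun n : ℕ => t ^ (2 * n) * (zetaX x (wordEven n) : ℂ) := by
  simp only [wordEven_eq_altWord]
  exact (hasSum_altWord hx0 hx1 t).summable.comp_injective
    (i := fun n : ℕ => 2 * n) (mul_right_injective₀ two_ne_zero)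

lemma summable_odd {x : ℝ} (hx0 : 0 ≤ x) (hx1 : x ≤ 1) (t : ℂ) :
    Summable fun n : ℕ => t ^ (2 * n + 1) * (zetaX x (wordOdd n) : ℂ) := by
  simp only [wordOdd_eq_altWord]
  exact (hasSum_altWord hx0 hx1 t).summable.comp_injective
    (i := fun n : ℕ => 2 * n + 1)
    ((add_left_injective 1).comp (mul_right_injective₀ two_ne_zero))

lemma M_eq_closedSeries {x : ℝ} (hx0 : 0 ≤ x) (hx1 : x ≤ 1) (t : ℂ) :
    M x t = closedSeries (altSums 1) t (-x) := by
  have he := summable_even hx0 hx1 t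
  have ho := summable_odd hx0 hx1 t
  rw [M, he.tsum_add ho, ← (hasSum_altWord hx0 hx1 t).tsum_eq]
  simp only [wordEven_eq_altWord, wordOdd_eq_altWord] at he ho ⊢
  exact tsum_even_add_odd (f := fun k : ℕ => t ^ k * (zetaX x (altWord (-1) k) : ℂ)) he ho

/-! ### The product for `A` -/

lemma depthGen_barSums (w : ℂ) (n : ℕ) :
    depthGen barSums w n = ∏ j ∈ Finset.range n, (1 + w * ((-1) ^ j / j)) := by
  induction n with
  | zero => rw [isNested_barSums.depthGen_zero, Finset.prod_range_zero]
  | succ n ih =>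
    rw [isNested_barSums.depthGen_succ rapidDecay_barSums, Finset.prod_range_succ, ← ih]
    push_cast
    ring

/-- `A(w)` is the limit of its partial products, as the limits in the depth and in the truncation
bound may be exchanged. -/
lemma tendsto_depthGen_barSums (w : ℂ) :
    Tendsto (depthGen barSums w) atTop (𝓝 (A w)) := by
  obtain ⟨C, hC⟩ := self_bounded isNested_barSums (τ := 2 * (‖w‖ + 1)) (by positivity)
  refine tendsto_tsum_of_dominated_convergence (bound := fun k => C * (1 / 2) ^ k)
    (summable_geometric_two.mul_left C) (fun k => ?_) (Eventually.of_forall fun n k => ?_)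
  · exact ((Complex.continuous_ofReal.tendsto _).comp (tendsto_zetaX_wordBar k)).const_mul _
  · rw [norm_mul, norm_pow, Complex.norm_real, Real.norm_eq_abs]
    exact pow_mul_le_geometric (abs_nonneg _) (norm_nonneg _) (hC k n)

/-- The partial products `∏_{0<j<n} (1 - w² / j²)` of `sin (π w) / (π w)`; the factor `j = 0` is
`1`, because `w² / 0 = 0`. -/
noncomputable def sineProd (w : ℂ) (n : ℕ) : ℂ :=
  ∏ j ∈ Finset.range n, (1 - w ^ 2 / (j : ℂ) ^ 2)

lemma sineProd_succ (w : ℂ) (n : ℕ) :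
    sineProd w (n + 1) = sineProd w n * (1 - w ^ 2 / (n : ℂ) ^ 2) := Finset.prod_range_succ _ _

/-- `A(w) A(-w)` is the sine product. -/
lemma tendsto_sineProd (w : ℂ) : Tendsto (sineProd w) atTop (𝓝 (A w * A (-w))) := by
  refine ((tendsto_depthGen_barSums w).mul (tendsto_depthGen_barSums (-w))).congr fun n => ?_
  rw [depthGen_barSums, depthGen_barSums, sineProd, ← Finset.prod_mul_distrib]
  refine Finset.prod_congr rfl fun j _ => ?_
  have : ((-1 : ℂ) ^ j) ^ 2 = 1 := by rw [← pow_mul, mul_comm, pow_mul]; simp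
  linear_combination (-(w ^ 2 / (j : ℂ) ^ 2)) * this

/-! ### The hypergeometric functions -/

/-- The bound `∑ 1 / j²` for the exponents in the sine product. -/
noncomputable def invSqSum : ℝ := ∑' j : ℕ, 1 / (j : ℝ) ^ 2

lemma norm_sineProd_le (w : ℂ) (n : ℕ) : ‖sineProd w n‖ ≤ Real.exp (‖w‖ ^ 2 * invSqSum) := by
  have hs : Summable fun j : ℕ => 1 / (j : ℝ) ^ 2 := Real.summable_one_div_nat_pow.mpr one_lt_two
  calc ‖sineProd w n‖ ≤ ∏ j ∈ Finset.range n, Real.exp (‖w‖ ^ 2 * (1 / (j : ℝ) ^ 2)) := by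
        rw [sineProd, norm_prod]
        refine Finset.prod_le_prod (fun _ _ => norm_nonneg _) fun j _ => ?_
        refine (norm_sub_le _ _).trans ?_
        rw [norm_one, norm_div, norm_pow, norm_pow, Complex.norm_natCast, ← mul_one_div, add_comm]
        exact Real.add_one_le_exp _
    _ = Real.exp (‖w‖ ^ 2 * ∑ j ∈ Finset.range n, 1 / (j : ℝ) ^ 2) := by
        rw [← Real.exp_sum, Finset.mul_sum]
    _ ≤ _ := by
        refine Real.exp_le_exp.mpr (mul_le_mul_of_nonneg_left ?_ (by positivity))
        exact hs.sum_le_tsum _ fun j _ => by positivity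

lemma sineProd_growth (w : ℂ) (n : ℕ) :
    ‖sineProd w n‖ ≤ Real.exp (‖w‖ ^ 2 * invSqSum) * ((n : ℝ) + 1) :=
  (norm_sineProd_le w n).trans
    (le_mul_of_one_le_right (Real.exp_nonneg _) (by linarith [Nat.cast_nonneg (α := ℝ) n]))

/-- The series `∑ yⁿ pₙ / n²` for the partial sine products `pₙ`. -/
noncomputable def dilogSeries (w : ℂ) (y : ℝ) : ℂ := logSeries (fun n => sineProd w n / n) y

lemma norm_dilog_term_le (w : ℂ) {y : ℝ} (hy : |y| ≤ 1) (n : ℕ) :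
    ‖(y : ℂ) ^ n * (sineProd w n / n / n)‖
      ≤ Real.exp (‖w‖ ^ 2 * invSqSum) * (1 / (n : ℝ) ^ 2) := by
  rw [norm_mul, norm_pow, Complex.norm_real, Real.norm_eq_abs, norm_div, norm_div,
    Complex.norm_natCast, div_div, ← sq, ← mul_one_div]
  refine (mul_le_of_le_one_left (by positivity) (pow_le_one₀ (abs_nonneg _) hy)).trans ?_
  gcongr
  exact norm_sineProd_le w n

lemma summable_inv_sq (C : ℝ) : Summable fun n : ℕ => C * (1 / (n : ℝ) ^ 2) :=
  (Real.summable_one_div_nat_pow.mpr one_lt_two).mul_left C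

lemma summable_dilog (w : ℂ) {y : ℝ} (hy : |y| ≤ 1) :
    Summable fun n : ℕ => (y : ℂ) ^ n * (sineProd w n / n / n) :=
  Summable.of_norm_bounded (summable_inv_sq _) (norm_dilog_term_le w hy)

lemma continuousOn_dilogSeries (w : ℂ) : ContinuousOn (dilogSeries w) (Set.Icc (-1) 1) :=
  continuousOn_tsum (fun n => by fun_prop) (summable_inv_sq _)
    fun n _ hy => norm_dilog_term_le w (abs_le.mpr hy) n

lemma hasDerivAt_sineSeries (w : ℂ) {y : ℝ} (hy : |y| < 1) :
    HasDerivAt (logSeries (sineProd w)) ((1 - w ^ 2 * dilogSeries w y) / (1 - y)) y := by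
  have := hasDerivAt_logSeries (h' := fun n => sineProd w n / n) (w := -w ^ 2) (η := 1)
    (sineProd_growth w) (by simp [sineProd]) (fun n => ?_) hy
  · refine this.congr_deriv ?_
    rw [one_mul, dilogSeries, neg_mul, ← sub_eq_add_neg]
  · rw [sineProd_succ]
    push_cast
    ring

lemma hasDerivAt_dilogSeries (w : ℂ) {y : ℝ} (hy : |y| < 1) (hy0 : y ≠ 0) :
    HasDerivAt (dilogSeries w) (logSeries (sineProd w) y / y) y := by
  refine (hasDerivAt_logSeries_tsum (norm_div_natCast_le (sineProd_growth w)) hy).congr_deriv ?_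
  have hs := summable_pow_mul_of_linear_growth (norm_div_natCast_le (sineProd_growth w)) hy
  rw [eq_div_iff (by exact_mod_cast hy0), logSeries, hs.tsum_eq_zero_add, ← tsum_mul_right]
  simp only [Nat.cast_zero, div_zero, mul_zero, zero_add]
  refine tsum_congr fun n => ?_
  ring

/-- `(w)ₙ₊₁ (-w)ₙ₊₁` in terms of the sine product. -/
lemma ascPochhammer_mul_neg (w : ℂ) (n : ℕ) :
    (ascPochhammer ℂ (n + 1)).eval w * (ascPochhammer ℂ (n + 1)).eval (-w)
      = -w ^ 2 * (n.factorial : ℂ) ^ 2 * sineProd w (n + 1) := by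
  induction n with
  | zero => simp [sineProd]; ring
  | succ n ih =>
    have hn : (n : ℂ) + 1 ≠ 0 := by exact_mod_cast n.succ_ne_zero
    rw [ascPochhammer_succ_eval _ w, ascPochhammer_succ_eval _ (-w), sineProd_succ _ (n + 1),
      Nat.factorial_succ, mul_mul_mul_comm, ih]
    push_cast
    field_simp
    ring

lemma ascPochhammer_one_add_mul (w : ℂ) (n : ℕ) :
    (ascPochhammer ℂ n).eval (1 + w) * (ascPochhammer ℂ n).eval (1 - w)
      = (n.factorial : ℂ) ^ 2 * sineProd w (n + 1) := by
  induction n with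
  | zero => simp [sineProd]
  | succ n ih =>
    have hn : (n : ℂ) + 1 ≠ 0 := by exact_mod_cast n.succ_ne_zero
    rw [ascPochhammer_succ_eval, ascPochhammer_succ_eval, sineProd_succ _ (n + 1),
      Nat.factorial_succ, mul_mul_mul_comm, ih]
    push_cast
    field_simp
    ring

lemma ascPochhammer_eval_two (n : ℕ) :
    (ascPochhammer ℂ n).eval 2 = ((n + 1).factorial : ℂ) := by
  induction n with
  | zero => simp
  | succ n ih =>
    rw [ascPochhammer_succ_eval, ih, Nat.factorial_succ (n + 1)]
    push_cast
    ring

lemma Y₁_eq (w : ℂ) {y : ℝ} (hy : |y| ≤ 1) : Y₁ y w = 1 - w ^ 2 * dilogSeries w y := by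
  have hs := summable_dilog w hy
  have hcoeff : ∀ n : ℕ, ((((n + 1).factorial : ℂ)⁻¹ * (ascPochhammer ℂ (n + 1)).eval w *
      (ascPochhammer ℂ (n + 1)).eval (-w) * ((ascPochhammer ℂ (n + 1)).eval 1)⁻¹) • (y : ℂ) ^ (n + 1))
      = -w ^ 2 * ((y : ℂ) ^ (n + 1) * (sineProd w (n + 1) / (n + 1 : ℕ) / (n + 1 : ℕ))) := by
    intro n
    have hn : (n : ℂ) + 1 ≠ 0 := by exact_mod_cast n.succ_ne_zero
    have hf : (n.factorial : ℂ) ≠ 0 := by exact_mod_cast n.factorial_ne_zero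
    rw [mul_assoc (((n + 1).factorial : ℂ)⁻¹), ascPochhammer_mul_neg, ascPochhammer_eval_one,
      Nat.factorial_succ, smul_eq_mul]
    push_cast
    field_simp
  have hs1 := ((summable_nat_add_iff 1).mpr hs).mul_left (-w ^ 2)
  rw [Y₁, ordinaryHypergeometric_eq_tsum]
  beta_reduce
  rw [((summable_nat_add_iff 1).mp (hs1.congr fun n => (hcoeff n).symm)).tsum_eq_zero_add,
    tsum_congr hcoeff, tsum_mul_left, dilogSeries, logSeries, hs.tsum_eq_zero_add]
  simp [sub_eq_add_neg]

lemma Y₂_eq (w : ℂ) {y : ℝ} (hy : |1 - y| < 1) :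
    Y₂ y w = logSeries (sineProd w) (1 - y) := by
  have hs := summable_pow_mul_of_linear_growth (norm_div_natCast_le (sineProd_growth w)) hy
  rw [Y₂, ordinaryHypergeometric_eq_tsum, logSeries, hs.tsum_eq_zero_add]
  beta_reduce
  rw [← tsum_mul_left]
  simp only [Nat.cast_zero, div_zero, mul_zero, zero_add]
  refine tsum_congr fun n => ?_
  have hn : (n : ℂ) + 1 ≠ 0 := by exact_mod_cast n.succ_ne_zero
  have hf : (n.factorial : ℂ) ≠ 0 := by exact_mod_cast n.factorial_ne_zero
  rw [mul_assoc ((n.factorial : ℂ)⁻¹), ascPochhammer_one_add_mul, ascPochhammer_eval_two,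
    Nat.factorial_succ, smul_eq_mul]
  push_cast
  field_simp
  ring

/-- The function `U(·, w)` in the variable `y = 1 - 2s`, in which the two singular points `s = 1`
and `s = 0` of the hypergeometric equation become `∓1`. -/
noncomputable def centredU (w : ℂ) (y : ℝ) : ℂ :=
  1 - w ^ 2 * dilogSeries w ((1 - y) / 2) - w * logSeries (sineProd w) ((1 + y) / 2)

lemma U_eq_centredU (w : ℂ) {x : ℝ} (hx0 : 0 ≤ x) (hx1 : x ≤ 1) :
    U ((1 + (x : ℂ)) / 2) w = centredU w (-x) := by
  have e : (1 + (x : ℂ)) / 2 = (((1 + x) / 2 : ℝ) : ℂ) := by push_cast; ring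
  have h1 : |(1 + x) / 2| ≤ 1 := by rw [abs_le]; constructor <;> linarith
  have h2 : |1 - (1 + x) / 2| < 1 := by rw [abs_lt]; constructor <;> linarith
  rw [e, U, Y₁_eq w h1, Y₂_eq w h2, centredU]
  congr 3
  all_goals ring_nf

/-- The hypergeometric equation as a first-order equation that couples `y` to `-y`. -/
lemma hasDerivAt_centredU (w : ℂ) {y : ℝ} (hy : |y| < 1) :
    HasDerivAt (centredU w) (-w * centredU w (-y) / (1 - y)) y := by
  obtain ⟨hy1, hy2⟩ := abs_lt.mp hy
  have h1 : |(1 - y) / 2| < 1 := by rw [abs_lt]; constructor <;> linarith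
  have h2 : |(1 + y) / 2| < 1 := by rw [abs_lt]; constructor <;> linarith
  have hd1 : HasDerivAt (fun y : ℝ => (1 - y) / 2) (-1 / 2) y :=
    ((hasDerivAt_id y).const_sub 1).div_const 2
  have hd2 : HasDerivAt (fun y : ℝ => (1 + y) / 2) (1 / 2) y :=
    ((hasDerivAt_id y).const_add 1).div_const 2
  have k1 := (hasDerivAt_dilogSeries w h1 (by linarith)).scomp y hd1
  have k2 := (hasDerivAt_sineSeries w h2).scomp y hd2
  have := ((k1.const_mul (w ^ 2)).const_sub 1).sub (k2.const_mul w)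
  refine this.congr_deriv ?_
  have e1 : (1 : ℂ) - y ≠ 0 := by
    rw [sub_ne_zero]
    exact_mod_cast hy2.ne'
  have e2 : (1 - -y) / 2 = (1 + y) / 2 := by ring
  have e3 : (1 + -y) / 2 = (1 - y) / 2 := by ring
  have e4 : (1 : ℂ) - (1 + y) / 2 = (1 - y) / 2 := by ring
  rw [centredU, e2, e3]
  simp only [Complex.real_smul]
  push_cast
  rw [e4]
  field_simp
  ring

lemma continuousOn_centredU (w : ℂ) : ContinuousOn (centredU w) (Set.Icc (-1) 0) := by
  refine (continuousOn_const.sub (continuousOn_const.mul ?_)).sub (continuousOn_const.mul ?_)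
  · refine (continuousOn_dilogSeries w).comp (by fun_prop) fun y hy => ?_
    constructor <;> linarith [hy.1, hy.2]
  · refine (continuousOn_logSeries (sineProd_growth w)).comp (by fun_prop) fun y hy => ?_
    constructor <;> linarith [hy.1, hy.2]

/-- Gauss's evaluation of `₂F₁(w, -w; 1; 1)`: the partial sums telescope to the partial sine
products. -/
lemma centredU_neg_one (w : ℂ) : centredU w (-1) = A w * A (-w) := by
  have hsum : ∀ N, 1 - w ^ 2 * ∑ n ∈ Finset.range N, ((1 : ℝ) : ℂ) ^ n * (sineProd w n / n / n)
      = sineProd w N := by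
    intro N
    induction N with
    | zero => simp [sineProd]
    | succ N ih =>
      rw [Finset.sum_range_succ, sineProd_succ, mul_sub, mul_one]
      nth_rewrite 2 [← ih]
      push_cast
      ring
  have hlim := ((summable_dilog w (y := 1) (by simp)).hasSum.tendsto_sum_nat.const_mul
    (w ^ 2)).const_sub 1
  have h2 : centredU w (-1) = 1 - w ^ 2 * dilogSeries w 1 := by
    rw [centredU]
    norm_num [logSeries_zero]
  rw [h2]
  exact tendsto_nhds_unique hlim ((tendsto_sineProd w).congr fun N => (hsum N).symm)

lemma differentiable_sineProd (n : ℕ) : Differentiable ℂ fun w => sineProd w n := by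
  unfold sineProd
  fun_prop

/-- `U(1/2, w)` is entire in `w`. -/
lemma differentiable_centredU_zero : Differentiable ℂ fun w => centredU w 0 := by
  have hbound : ∀ {w w₀ : ℂ}, w ∈ Metric.ball (0 : ℂ) (‖w₀‖ + 1) → ∀ n,
      ‖sineProd w n‖ ≤ Real.exp ((‖w₀‖ + 1) ^ 2 * invSqSum) := by
    intro w w₀ hw n
    refine (norm_sineProd_le w n).trans (Real.exp_le_exp.mpr ?_)
    have h0 : 0 ≤ invSqSum := tsum_nonneg fun j => by positivity
    have := (mem_ball_zero_iff.mp hw).le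
    gcongr
  have key : ∀ c : ℕ → ℂ, (∀ n, ‖c n‖ ≤ 1) → Differentiable ℂ fun w =>
      ∑' n : ℕ, (((1 / 2 : ℝ)) : ℂ) ^ n * (c n * sineProd w n) := by
    intro c hc w₀
    have := Complex.differentiableOn_tsum_of_summable_norm (U := Metric.ball (0 : ℂ) (‖w₀‖ + 1))
      (F := fun (n : ℕ) (w : ℂ) => (((1 / 2 : ℝ)) : ℂ) ^ n * (c n * sineProd w n))
      (u := fun n => (1 / 2) ^ n * (1 * Real.exp ((‖w₀‖ + 1) ^ 2 * invSqSum)))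
      (summable_geometric_two.mul_right _)
      (fun n => (((differentiable_sineProd n).const_mul _).const_mul _).differentiableOn)
      Metric.isOpen_ball ?_
    · exact this.differentiableAt (Metric.isOpen_ball.mem_nhds (by simp))
    · intro n w hw
      rw [norm_mul, norm_mul, norm_pow, Complex.norm_real, Real.norm_of_nonneg (by norm_num)]
      gcongr
      · exact hc n
      · exact hbound hw n
  have hinv : ∀ n : ℕ, ‖((n : ℂ))⁻¹‖ ≤ 1 := by
    intro n
    rw [norm_inv, Complex.norm_natCast]
    rcases n with _ | n
    · simp
    · exact inv_le_one_of_one_le₀ (by push_cast; linarith [Nat.cast_nonneg (α := ℝ) n])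
  have d1 := key (fun n => (n : ℂ)⁻¹ * (n : ℂ)⁻¹) fun n => by
    rw [norm_mul]
    exact mul_le_one₀ (hinv n) (norm_nonneg _) (hinv n)
  have d2 := key (fun n => (n : ℂ)⁻¹) hinv
  have e1 : (fun w => centredU w 0) = fun w => 1
      - w ^ 2 * (∑' n : ℕ, (((1 / 2 : ℝ)) : ℂ) ^ n * ((n : ℂ)⁻¹ * (n : ℂ)⁻¹ * sineProd w n))
      - w * (∑' n : ℕ, (((1 / 2 : ℝ)) : ℂ) ^ n * ((n : ℂ)⁻¹ * sineProd w n)) := by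
    funext w
    rw [centredU, dilogSeries, logSeries, logSeries, sub_zero, add_zero]
    simp only [div_eq_mul_inv _ (Nat.cast _)]
    congr 2
    · exact congrArg _ (tsum_congr fun n => by ring)
    · exact tsum_congr fun n => by ring
  rw [e1]
  fun_prop

/-! ### Comparison of the solutions -/

lemma norm_one_div_one_add_le {x : ℝ} (hx0 : 0 ≤ x) (hx1 : x < 1) (c : ℂ) :
    ‖c / (1 + x)‖ ≤ ‖c‖ / (1 - x) := by
  have e : (1 : ℂ) + x = ((1 + x : ℝ) : ℂ) := by push_cast; ring
  rw [norm_div, e, Complex.norm_real, Real.norm_of_nonneg (by linarith)]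
  exact div_le_div_of_nonneg_left (norm_nonneg c) (by linarith) (by linarith)

lemma norm_one_div_one_sub_le {x : ℝ} (hx1 : x < 1) (c : ℂ) :
    ‖c / (1 - x)‖ ≤ ‖c‖ / (1 - x) := by
  have e : (1 : ℂ) - x = ((1 - x : ℝ) : ℂ) := by push_cast; ring
  rw [norm_div, e, Complex.norm_real, Real.norm_of_nonneg (by linarith)]

/-- Reflection of a derivative. -/
lemma hasDerivAt_reflect {f : ℝ → ℂ} {f' : ℂ} {x : ℝ} (h : HasDerivAt f f' (-x)) :
    HasDerivAt (fun x => f (-x)) (-f') x := by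
  have := h.scomp x (hasDerivAt_neg x)
  rw [neg_one_smul] at this
  exact this

lemma hasDerivAt_barSeries (w : ℂ) {y : ℝ} (hy : |y| < 1) :
    HasDerivAt (nestedSeries barSums w) (w * nestedSeries barSums w (-y) / (1 - y)) y := by
  simpa using isNested_barSums.hasDerivAt_nestedSeries rapidDecay_barSums w hy

/-- The two sides solve the same system and agree at `y = 0`. -/
lemma centredU_eq_mul_nestedSeries (w : ℂ) {x : ℝ} (hx0 : 0 ≤ x) (hx1 : x < 1) :
    centredU w (-x) = centredU w 0 * nestedSeries barSums (-w) (-x) := by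
  set D : ℝ → ℂ := fun y => centredU w y - centredU w 0 * nestedSeries barSums (-w) y with hD
  have hder : ∀ y : ℝ, |y| < 1 → HasDerivAt D (-w * D (-y) / (1 - y)) y := by
    intro y hy
    refine ((hasDerivAt_centredU w hy).sub
      ((hasDerivAt_barSeries (-w) hy).const_mul (centredU w 0))).congr_deriv ?_
    simp only [hD]
    ring
  have hD0 : D 0 = 0 := by simp [hD, nestedSeries_at_zero]
  have key := eq_zero_of_linear_system (n := 2) (Y := ![D, fun x => D (-x)])
    (c := ![fun x => -w / (1 - x), fun x => w / (1 + x)]) (π := ![1, 0]) (norm_nonneg w)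
    ?_ ?_ ?_ 1 hx0 hx1
  · exact sub_eq_zero.mp key
  · intro i x hx0 hx1
    fin_cases i
    · simpa using norm_one_div_one_sub_le hx1 (-w)
    · exact norm_one_div_one_add_le hx0 hx1 w
  · intro i x hx0 hx1
    have hx : |x| < 1 := abs_lt.mpr ⟨by linarith, hx1⟩
    fin_cases i
    · refine (hder x hx).congr_deriv ?_
      simp
      ring
    · refine (hasDerivAt_reflect (hder (-x) (by rwa [abs_neg]))).congr_deriv ?_
      simp
      ring
  · intro i
    fin_cases i <;> simp [hD0]

/-- Both factors solve `(1 - y) f'(y) = c f(-y)` with `c = z` and `c = -iz`; since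
`z² + (-iz)² = 0`, their product and the combination of their reflections below satisfy the system
of the alternating words. -/
lemma altSeries_eq_mul (t : ℂ) {x : ℝ} (hx0 : 0 ≤ x) (hx1 : x < 1) :
    nestedSeries (altSums 1) t (-x)
      = nestedSeries barSums ((1 + Complex.I) * t / 2) (-x)
        * nestedSeries barSums ((1 - Complex.I) * t / 2) (-x) := by
  set a : ℝ → ℂ := nestedSeries barSums ((1 + Complex.I) * t / 2)
  set b : ℝ → ℂ := nestedSeries barSums ((1 - Complex.I) * t / 2)
  set G : ℝ → ℂ := fun y => nestedSeries (altSums 1) t y - a y * b y with hG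
  set F : ℝ → ℂ := fun y => nestedSeries (altSums (-1)) t y
    - ((1 + Complex.I) / 2 * (a (-y) * b y) + (1 - Complex.I) / 2 * (a y * b (-y))) with hF
  have ha : ∀ y : ℝ, |y| < 1 → HasDerivAt a ((1 + Complex.I) * t / 2 * a (-y) / (1 - y)) y :=
    fun y hy => hasDerivAt_barSeries _ hy
  have hb : ∀ y : ℝ, |y| < 1 → HasDerivAt b ((1 - Complex.I) * t / 2 * b (-y) / (1 - y)) y :=
    fun y hy => hasDerivAt_barSeries _ hy
  have hI : Complex.I ^ 2 = -1 := Complex.I_sq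
  have hG' : ∀ y : ℝ, |y| < 1 → HasDerivAt G (t * F y / (1 - y)) y := by
    intro y hy
    have h1 := isNested_altSums_one.hasDerivAt_nestedSeries rapidDecay_altSums_one t hy
    refine (h1.sub ((ha y hy).mul (hb y hy))).congr_deriv ?_
    simp only [hF, one_mul]
    ring
  have hF' : ∀ y : ℝ, |y| < 1 → HasDerivAt F (t * G (-y) / (1 - y)) y := by
    intro y hy
    have hy' : |-y| < 1 := by rwa [abs_neg]
    have h1 := isNested_altSums_neg_one.hasDerivAt_nestedSeries rapidDecay_altSums_neg_one t hy
    have ha' := hasDerivAt_reflect (ha (-y) hy')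
    have hb' := hasDerivAt_reflect (hb (-y) hy')
    refine (h1.sub (((ha'.mul (hb y hy)).const_mul ((1 + Complex.I) / 2)).add
      (((ha y hy).mul hb').const_mul ((1 - Complex.I) / 2)))).congr_deriv ?_
    simp only [hG, neg_one_mul, neg_neg]
    push_cast
    rw [sub_neg_eq_add]
    linear_combination (t / 2 * a y * b y / (1 + y) + t / 2 * a (-y) * b (-y) / (1 - y)) * hI
  have hG0 : G 0 = 0 := by simp [hG, a, b, nestedSeries_at_zero]
  have hF0 : F 0 = 0 := by
    simp [hF, a, b, nestedSeries_at_zero]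
    ring
  have key := eq_zero_of_linear_system (n := 4)
    (Y := ![G, fun x => G (-x), F, fun x => F (-x)])
    (c := ![fun x => t / (1 - x), fun x => -t / (1 + x), fun x => t / (1 - x),
      fun x => -t / (1 + x)]) (π := ![2, 3, 1, 0]) (norm_nonneg t) ?_ ?_ ?_ 1 hx0 hx1
  · exact sub_eq_zero.mp key
  · intro i x hx0 hx1
    fin_cases i
    · exact norm_one_div_one_sub_le hx1 t
    · simpa using norm_one_div_one_add_le hx0 hx1 (-t)
    · exact norm_one_div_one_sub_le hx1 t
    · simpa using norm_one_div_one_add_le hx0 hx1 (-t)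
  · intro i x hx0 hx1
    have hx : |x| < 1 := abs_lt.mpr ⟨by linarith, hx1⟩
    have hx' : |-x| < 1 := by rwa [abs_neg]
    fin_cases i
    -- the four unknowns are `G(x)`, `G(-x)`, `F(x)`, `F(-x)`
    · refine (hG' x hx).congr_deriv ?_
      simp
      ring
    · refine (hasDerivAt_reflect (hG' (-x) hx')).congr_deriv ?_
      simp
      ring
    · refine (hF' x hx).congr_deriv ?_
      simp
      ring
    · refine (hasDerivAt_reflect (hF' (-x) hx')).congr_deriv ?_
      simp
      ring
  · intro i
    fin_cases i <;> simp [hG0, hF0]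

/-! ### Passage to the endpoint and the connection constant -/

lemma eqOn_Icc_of_forall_neg {f g : ℝ → ℂ} (hf : ContinuousOn f (Set.Icc (-1) 0))
    (hg : ContinuousOn g (Set.Icc (-1) 0)) (h : ∀ x, 0 ≤ x → x < 1 → f (-x) = g (-x)) :
    Set.EqOn f g (Set.Icc (-1) 0) := by
  have h1 : Set.EqOn f g (Set.Ioc (-1) 0) := fun y hy => by
    simpa using h (-y) (by linarith [hy.2]) (by linarith [hy.1])
  exact h1.of_subset_closure hf hg Set.Ioc_subset_Icc_self
    (by rw [closure_Ioc (by norm_num)])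

lemma continuousOn_barSeries (w : ℂ) :
    ContinuousOn (closedSeries barSums w) (Set.Icc (-1 : ℝ) 0) :=
  continuousOn_closedSeries isNested_barSums (by norm_num) rapidDecay_barSums
    rapidDecay_barSums w

lemma closed_barSeries_eq (w : ℂ) {y : ℝ} (hy : |y| < 1) :
    closedSeries barSums w y = nestedSeries barSums w y :=
  closedSeries_eq_nestedSeries isNested_barSums (by norm_num) rapidDecay_barSums
    rapidDecay_barSums w hy

lemma centredU_eq_mul (w : ℂ) {y : ℝ} (hy : y ∈ Set.Icc (-1 : ℝ) 0) :
    centredU w y = centredU w 0 * closedSeries barSums (-w) y :=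
  eqOn_Icc_of_forall_neg (g := fun y => centredU w 0 * closedSeries barSums (-w) y)
    (continuousOn_centredU w) (continuousOn_const.mul (continuousOn_barSeries (-w)))
    (fun x hx0 hx1 => by
      rw [closed_barSeries_eq (-w) (by rwa [abs_neg, abs_of_nonneg hx0])]
      exact centredU_eq_mul_nestedSeries w hx0 hx1) hy

lemma M_eq_mul (t : ℂ) {x : ℝ} (hx0 : 0 ≤ x) (hx1 : x ≤ 1) :
    M x t = closedSeries barSums ((1 + Complex.I) * t / 2) (-x)
      * closedSeries barSums ((1 - Complex.I) * t / 2) (-x) := by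
  rw [M_eq_closedSeries hx0 hx1]
  refine eqOn_Icc_of_forall_neg
    (g := fun y => closedSeries barSums ((1 + Complex.I) * t / 2) y
      * closedSeries barSums ((1 - Complex.I) * t / 2) y)
    (continuousOn_closedSeries isNested_altSums_one (by norm_num) rapidDecay_altSums_one
      rapidDecay_altSums_neg_one t)
    ((continuousOn_barSeries _).mul (continuousOn_barSeries _))
    (fun x hx0 hx1 => ?_) (neg_mem_Icc hx0 hx1)
  have hx : |-x| < 1 := by rwa [abs_neg, abs_of_nonneg hx0]
  rw [closedSeries_eq_nestedSeries isNested_altSums_one (by norm_num) rapidDecay_altSums_one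
    rapidDecay_altSums_neg_one t hx, closed_barSeries_eq _ hx, closed_barSeries_eq _ hx]
  exact altSeries_eq_mul t hx0 hx1

lemma differentiable_A : Differentiable ℂ A := by
  have : A = fun z => closedSeries barSums z (-1) := funext A_eq_closedSeries
  rw [this]
  exact differentiable_closedSeries isNested_barSums (by norm_num) rapidDecay_barSums
    rapidDecay_barSums (by norm_num)

/-- `U(1/2, w) = A(w)`. Comparison of the two sides of `centredU_eq_mul` at `y = -1` gives this
after multiplication by `A(-w)`, hence near `w = 0`, where `A(-w) ≠ 0`, and then everywhere by the
identity theorem. -/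
lemma centredU_zero_eq_A (w : ℂ) : centredU w 0 = A w := by
  have hmul : ∀ w, centredU w 0 * A (-w) = A w * A (-w) := by
    intro w
    rw [← centredU_neg_one, centredU_eq_mul w (y := -1) (by norm_num), ← A_eq_closedSeries]
  have hA0 : A (-0) ≠ 0 := by
    rw [A_eq_closedSeries]
    simp [closedSeries]
  have hcont : ContinuousAt (fun w => A (-w)) 0 :=
    (differentiable_A.continuous.comp continuous_neg).continuousAt
  have hev : (fun w => centredU w 0) =ᶠ[𝓝 0] A := by
    filter_upwards [hcont.eventually_ne hA0] with w hw
    exact mul_right_cancel₀ hw (hmul w)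
  exact congrFun (AnalyticOnNhd.eq_of_eventuallyEq
    (fun w _ => differentiable_centredU_zero.analyticAt w)
    (fun w _ => differentiable_A.analyticAt w) hev) w

end EulerSums

theorem proposition2 :
    -- the Euler sums defining `A`, and the series `A`, converge
    ((∀ n : ℕ, Tendsto (EulerSums.zetaTrunc 1 (EulerSums.wordBar n)) atTop
        (𝓝 (EulerSums.zetaX 1 (EulerSums.wordBar n)))) ∧
      (∀ w : ℂ, Summable fun n : ℕ =>
        w ^ n * (EulerSums.zetaX 1 (EulerSums.wordBar n) : ℂ))) ∧
    ∀ x : ℝ, 0 ≤ x → x ≤ 1 →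
      -- the coefficients of `M(x, ·)` exist as convergent sums
      (∀ n : ℕ, Tendsto (EulerSums.zetaTrunc x (EulerSums.wordEven n)) atTop
        (𝓝 (EulerSums.zetaX x (EulerSums.wordEven n)))) ∧
      (∀ n : ℕ, Tendsto (EulerSums.zetaTrunc x (EulerSums.wordOdd n)) atTop
        (𝓝 (EulerSums.zetaX x (EulerSums.wordOdd n)))) ∧
      -- the power series converges everywhere and its sum is entire
      (∀ t : ℂ, Summable fun n : ℕ =>
        t ^ (2 * n) * (EulerSums.zetaX x (EulerSums.wordEven n) : ℂ)) ∧
      (∀ t : ℂ, Summable fun n : ℕ =>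
        t ^ (2 * n + 1) * (EulerSums.zetaX x (EulerSums.wordOdd n) : ℂ)) ∧
      Differentiable ℂ (EulerSums.M x) ∧
      -- the product formula
      (∀ t z s : ℂ, z = (1 + Complex.I) * t / 2 → s = (1 + (x : ℂ)) / 2 →
        EulerSums.A (-z) * EulerSums.A (Complex.I * z) ≠ 0 →
        EulerSums.M x t =
          EulerSums.U s (-z) * EulerSums.U s (Complex.I * z) /
            (EulerSums.A (-z) * EulerSums.A (Complex.I * z))) := by
  refine ⟨⟨EulerSums.tendsto_zetaX_wordBar, fun w => (EulerSums.hasSum_wordBar w).summable⟩,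
    fun x hx0 hx1 => ⟨fun n => ?_, fun n => ?_, EulerSums.summable_even hx0 hx1,
      EulerSums.summable_odd hx0 hx1, ?_, ?_⟩⟩
  · rw [EulerSums.wordEven_eq_altWord]
    exact EulerSums.tendsto_zetaX_altWord hx0 hx1 _
  · rw [EulerSums.wordOdd_eq_altWord]
    exact EulerSums.tendsto_zetaX_altWord hx0 hx1 _
  · have : EulerSums.M x = fun t => EulerSums.closedSeries (EulerSums.altSums 1) t (-x) :=
      funext (EulerSums.M_eq_closedSeries hx0 hx1)
    rw [this]
    exact EulerSums.differentiable_closedSeries EulerSums.isNested_altSums_one (by norm_num)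
      EulerSums.rapidDecay_altSums_one EulerSums.rapidDecay_altSums_neg_one
      (EulerSums.neg_mem_Icc hx0 hx1)
  · intro t z s hz hs hA
    have e : -(Complex.I * z) = (1 - Complex.I) * t / 2 := by
      rw [hz]
      linear_combination (-t / 2) * Complex.I_sq
    rw [eq_div_iff hA, EulerSums.M_eq_mul t hx0 hx1, hs, EulerSums.U_eq_centredU _ hx0 hx1,
      EulerSums.U_eq_centredU _ hx0 hx1,
      EulerSums.centredU_eq_mul _ (EulerSums.neg_mem_Icc hx0 hx1),
      EulerSums.centredU_eq_mul (Complex.I * z) (EulerSums.neg_mem_Icc hx0 hx1),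
      EulerSums.centredU_zero_eq_A, EulerSums.centredU_zero_eq_A, neg_neg, e, ← hz]
    ring
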